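/- Let $\mathcal C$ be a set of $m\ge 1$ candidates and let $\Pi=(\pi_1,\dots,\pi_n)$, $n\ge 1$, be a profile of rankings (complete orders) of $\mathcal C$, repetitions allowed. For a ranking $\pi$ let $\mathrm{pos}_\pi(c)$ be the number of candidates that $\pi$ prefers to $c$. The Kendall--Tau distance $d_{\mathrm{KT}}(Q,\pi)$ is the number of pairs of candidates that $Q$ and $\pi$ order differently, the Kemeny score of a ranking $Q$ is $\sum_{i=1}^n d_{\mathrm{KT}}(Q,\pi_i)$, and $K(\Pi)$ is the set of Kemeny rankings, i.e. of the rankings of $\mathcal C$ with minimum Kemeny score. The maximum range of $\Pi$ is $$r_{\max}=\max_{c\in\mathcal C}\Bigl(\max_{i,j}\bigl|\mathrm{pos}_{\pi_i}(c)-\mathrm{pos}_{\pi_j}(c)\bigr|+1\Bigr).$$ In the problem Distinct OPT Kemeny Ranking Aggregation one is given $\mathcal C$, $\Pi$ and an integer $r\ge 0$, and has to output $\ell=\min\{r,|K(\Pi)|\}$ distinct Kemeny rankings of $\Pi$. **Theorem.** Distinct OPT Kemeny Ranking Aggregation is fixed-parameter tractable with respect to $r_{\max}$, in time $\mathcal O^*(32^{r_{\max}})$,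 where $\mathcal O^*$ hides factors polynomial in the input size and in the number of rankings to be output. Precisely: there are a deterministic algorithm (a program of a random access machine with logarithmic cost) and constants $C,k\in\mathbb N$ such that on every instance $(\mathcal C,\Pi,r)$ with $\mathcal C$ and $\Pi$ nonempty the algorithm halts with $\ell$ distinct Kemeny rankings of $\Pi$ as its output, after time at most $$C\cdot 32^{r_{\max}}\cdot (N+\ell)^{k},$$ where $N$ is the number of bits of the input ($r$ being written in binary), plus one for each number in it. -/

import Mathlib

namespace Kemeny

/-! ### Rankings, Kemeny scores, and the maximum range -/

/-- A ranking (complete order) of the candidates `0, …, m - 1`, given by the bijection that sends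
each candidate to its place; place `0` is the most preferred one. -/
abbrev Ranking (m : ℕ) : Type := Equiv.Perm (Fin m)

/-- `π.prefers a b`: candidate `a` is ranked before candidate `b` in `π`. -/
def prefers {m : ℕ} (π : Ranking m) (a b : Fin m) : Prop := π a < π b

instance {m : ℕ} (π : Ranking m) (a b : Fin m) : Decidable (prefers π a b) :=
  inferInstanceAs (Decidable (π a < π b))

/-- The position of `c` in `π`: the number of candidates preferred to `c`. -/
def pos {m : ℕ} (π : Ranking m) (c : Fin m) : ℕ :=
  (Finset.univ.filter fun c' : Fin m => prefers π c' c).card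

theorem pos_eq {m : ℕ} (π : Ranking m) (c : Fin m) : pos π c = (π c : ℕ) := by
  have h : (Finset.univ.filter fun c' : Fin m => prefers π c' c)
      = (Finset.Iio (π c)).map π.symm.toEmbedding := by
    ext x
    rw [Finset.mem_filter]
    simp [prefers]
  rw [pos, h, Finset.card_map, Fin.card_Iio]

/-- Kendall–Tau distance: the number of pairs of candidates which the two rankings order
differently. Each such unordered pair is counted once, as the ordered pair `(a, b)` with `a` before
`b` in `π`. -/
def ktDist {m : ℕ} (π σ : Ranking m) : ℕ :=
  (Finset.univ.filter fun p : Fin m × Fin m => prefers π p.1 p.2 ∧ prefers σ p.2 p.1).card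

/-- A profile: `n` votes (repetitions allowed), each of them a ranking of the `m` candidates. -/
abbrev Profile (m n : ℕ) : Type := Fin n → Ranking m

def kemenyScore {m n : ℕ} (V : Profile m n) (Q : Ranking m) : ℕ :=
  ∑ i, ktDist Q (V i)

/-- The set of (optimal) Kemeny rankings of a profile. -/
def kemenyRankings {m n : ℕ} (V : Profile m n) : Finset (Ranking m) :=
  Finset.univ.filter fun Q => ∀ Q' : Ranking m, kemenyScore V Q ≤ kemenyScore V Q'

/-- The range of a candidate: the largest difference of its positions in two votes, plus one. -/
def range {m n : ℕ} (V : Profile m n) (c : Fin m) : ℕ :=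
  (Finset.univ.sup fun p : Fin n × Fin n =>
    ((pos (V p.1) c : ℤ) - (pos (V p.2) c : ℤ)).natAbs) + 1

/-- The maximum range of a candidate in the profile. -/
def maxRange {m n : ℕ} (V : Profile m n) : ℕ :=
  Finset.univ.sup fun c : Fin m => range V c

/-! ### Random access machines with logarithmic cost -/

/-- Arithmetic on natural numbers; subtraction is truncated and `x / 0 = 0`, `x % 0 = x`. -/
inductive BinOp : Type
  | add | sub | mul | div | mod

def BinOp.eval : BinOp → ℕ → ℕ → ℕ
  | .add, u, v => u + v
  | .sub, u, v => u - v
  | .mul, u, v => u * v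
  | .div, u, v => u / v
  | .mod, u, v => u % v

/-- Programs of the machine. The numbers `x y z` are names of registers, `a` is the name of a memory
array; a program mentions only finitely many of them. -/
inductive Prog : Type
  /-- do nothing -/
  | skip : Prog
  /-- `R[x] := c` -/
  | const (x c : ℕ) : Prog
  /-- `R[x] := R[y] o R[z]` -/
  | op (o : BinOp) (x y z : ℕ) : Prog
  /-- `R[x] := M_a[R[y]]` -/
  | load (x a y : ℕ) : Prog
  /-- `M_a[R[y]] := R[x]` -/
  | store (a y x : ℕ) : Prog
  /-- run `p`, then `q` -/
  | seq (p q : Prog) : Prog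
  /-- `if R[x] < R[y] then p else q` -/
  | ifLt (x y : ℕ) (p q : Prog) : Prog
  /-- `while R[x] < R[y] do p` -/
  | whileLt (x y : ℕ) (p : Prog) : Prog

/-- A memory state: the contents of the registers and of the memory arrays. -/
structure State : Type where
  reg : ℕ → ℕ
  mem : ℕ → ℕ → ℕ

def State.setReg (s : State) (x v : ℕ) : State :=
  { s with reg := Function.update s.reg x v }

def State.setMem (s : State) (a i v : ℕ) : State :=
  { s with mem := Function.update s.mem a (Function.update (s.mem a) i v) }

/-- The charge for reading, writing or comparing numbers `u`, `v`: their bit length, plus one. -/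
def accessCost (u v : ℕ) : ℕ := 1 + Nat.size u + Nat.size v

/-- The charge for an arithmetic operation on `u`, `v`; it dominates the number of bit operations of
the schoolbook methods. -/
def opCost (u v : ℕ) : ℕ := (1 + Nat.size u) * (1 + Nat.size v)

/-- `Exec p s t s'`: the program `p`, started in the state `s`, halts in the state `s'` after time
`t`. -/
inductive Exec : Prog → State → ℕ → State → Prop
  | skip (s : State) : Exec .skip s 1 s
  | const (s : State) (x c : ℕ) : Exec (.const x c) s (accessCost c 0) (s.setReg x c)
  | op (s : State) (o : BinOp) (x y z : ℕ) :
      Exec (.op o x y z) s (opCost (s.reg y) (s.reg z))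
        (s.setReg x (o.eval (s.reg y) (s.reg z)))
  | load (s : State) (x a y : ℕ) :
      Exec (.load x a y) s (accessCost (s.reg y) (s.mem a (s.reg y)))
        (s.setReg x (s.mem a (s.reg y)))
  | store (s : State) (a y x : ℕ) :
      Exec (.store a y x) s (accessCost (s.reg y) (s.reg x))
        (s.setMem a (s.reg y) (s.reg x))
  | seq {p q : Prog} {s s' s'' : State} {t t' : ℕ} :
      Exec p s t s' → Exec q s' t' s'' → Exec (.seq p q) s (t + t') s''
  | ifTrue {x y : ℕ} {p q : Prog} {s s' : State} {t : ℕ} :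
      s.reg x < s.reg y → Exec p s t s' →
        Exec (.ifLt x y p q) s (accessCost (s.reg x) (s.reg y) + t) s'
  | ifFalse {x y : ℕ} {p q : Prog} {s s' : State} {t : ℕ} :
      ¬ s.reg x < s.reg y → Exec q s t s' →
        Exec (.ifLt x y p q) s (accessCost (s.reg x) (s.reg y) + t) s'
  | whileTrue {x y : ℕ} {p : Prog} {s s' s'' : State} {t t' : ℕ} :
      s.reg x < s.reg y → Exec p s t s' → Exec (.whileLt x y p) s' t' s'' →
        Exec (.whileLt x y p) s (accessCost (s.reg x) (s.reg y) + t + t') s''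
  | whileFalse {x y : ℕ} {p : Prog} {s : State} :
      ¬ s.reg x < s.reg y →
        Exec (.whileLt x y p) s (accessCost (s.reg x) (s.reg y)) s

/-- The machine is deterministic: the running time and the final state of a halting run are
determined by the program and the initial state. -/
theorem Exec.deterministic {p : Prog} {s s₁ s₂ : State} {t₁ t₂ : ℕ}
    (h₁ : Exec p s t₁ s₁) (h₂ : Exec p s t₂ s₂) : t₁ = t₂ ∧ s₁ = s₂ := by
  induction h₁ generalizing t₂ s₂ with
  | skip | const | op | load | store => cases h₂; exact ⟨rfl, rfl⟩
  | seq _ _ ih ih' =>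
    cases h₂ with
    | seq a b =>
      obtain ⟨rfl, rfl⟩ := ih a
      obtain ⟨rfl, rfl⟩ := ih' b
      exact ⟨rfl, rfl⟩
  | ifTrue hlt _ ih =>
    cases h₂ with
    | ifTrue _ a => obtain ⟨rfl, rfl⟩ := ih a; exact ⟨rfl, rfl⟩
    | ifFalse hn _ => exact absurd hlt hn
  | ifFalse hn _ ih =>
    cases h₂ with
    | ifTrue hlt _ => exact absurd hlt hn
    | ifFalse _ a => obtain ⟨rfl, rfl⟩ := ih a; exact ⟨rfl, rfl⟩
  | whileTrue hlt _ _ ih ih' =>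
    cases h₂ with
    | whileTrue _ a b =>
      obtain ⟨rfl, rfl⟩ := ih a
      obtain ⟨rfl, rfl⟩ := ih' b
      exact ⟨rfl, rfl⟩
    | whileFalse hn => exact absurd hlt hn
  | whileFalse hn =>
    cases h₂ with
    | whileTrue hlt _ _ => exact absurd hlt hn
    | whileFalse _ => exact ⟨rfl, rfl⟩

/-- The start of a run: the input word by word in the array `M_0`, zero everywhere else. -/
def startState (w : List ℕ) : State where
  reg := fun _ => 0
  mem := fun a i => if a = 0 then w.getD i 0 else 0

/-- The size of an input: the total number of bits, plus one for each number in it. -/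
def bitSize (w : List ℕ) : ℕ := (w.map fun v => 1 + Nat.size v).sum

/-! ### Distinct OPT Kemeny Ranking Aggregation -/

/-- A ranking as a list of candidates, the most preferred one first. -/
def rankingList {m : ℕ} (π : Ranking m) : List ℕ :=
  List.ofFn fun j : Fin m => (π.symm j : ℕ)

/-- The instance `(V, r)` as an input: `m`, `n`, `r`, and then the votes one after the other. -/
def instanceInput {m n : ℕ} (V : Profile m n) (r : ℕ) : List ℕ :=
  m :: n :: r :: (List.ofFn fun i : Fin n => rankingList (V i)).flatten

/-- The number `ℓ = min {r, |K(V)|}` of rankings that have to be found. -/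
def numSolutions {m n : ℕ} (V : Profile m n) (r : ℕ) : ℕ :=
  min r (kemenyRankings V).card

/-- The final state `s` holds a correct answer to the instance `(V, r)`: the number `ℓ` in the
register `R[0]`, and `ℓ` distinct Kemeny rankings one after the other in the array `M_1`, each as
the list of the candidates from the most preferred to the least preferred one. -/
def IsCorrectOutput {m n : ℕ} (V : Profile m n) (r : ℕ) (s : State) : Prop :=
  s.reg 0 = numSolutions V r ∧
    ∃ sols : Fin (numSolutions V r) → Ranking m,
      Function.Injective sols ∧ (∀ i, sols i ∈ kemenyRankings V) ∧
        ∀ (i : Fin (numSolutions V r)) (j : Fin m),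
          s.mem 1 ((i : ℕ) * m + (j : ℕ)) = ((sols i).symm j : ℕ)

end Kemeny

/-!
# Distinct optimal Kemeny ranking aggregation parameterized by the maximum range

All Kemeny rankings respect unanimous preferences, so every prefix of a Kemeny ranking is determined
by a cut in the first vote and a subset of a window of length `2 * maxRange V` after it. The machine
searches the graph of all pairs of such a prefix and its cost breadth first, and then lists the
paths to the cheapest complete prefix backwards.
-/

namespace Kemeny

/-! ### Expressions and their evaluation by the machine -/

/-! For everything ranked later, a prefix of a ranking matters only through its set of candidates
and its cost, the number of disagreements with the votes inside it. Two prefixes that agree in both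
can be exchanged under any continuation (`cost_append_add`, `IsOptimal.congr`). The two data are
packed into one number, `key`: the low `m` binary digits are the set, the higher part is the cost
plus one.

If all votes prefer `a` to `b`, so does every Kemeny ranking, since swapping the two in a ranking
with `b` first lowers the distance to every vote (`ktDist_swap_lt`, `lt_of_votes_eq`). Hence
prefixes of Kemeny rankings satisfy `IsPath`. Given a path, fix a vote and let `a` be its first
candidate outside the path. A member of the path stands fewer than `2 * maxRange V` places behind
`a`: positions differ by less than `maxRange V` between votes, so a candidate further behind would
be beaten by `a` in all votes. The set is therefore given by the place of `a` and a subset of a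
window. With at most `m * m * n + 1` costs this bounds the number of keys by `4 ^ maxRange V` times
a polynomial (`card_le_nodeBound`), well below base 32.

As the cost is part of the key, nothing has to be minimized during the search: plain reachability
finds all keys of paths (`SearchInv.mark_iff`), and the cheapest complete one is the optimum
(`isOptimal_of_first`). Rankings are then read off from the last place backwards. A suffix is kept
with the key of the prefix it leaves. The candidates that can come next are those in the prefix
whose removal gives the key of a path (`IsOptimal.extend`, `IsOptimal.prevKey_eq`), so there are no
dead ends. Distinct suffixes of equal length complete to distinct Kemeny rankings, so a level cut
off at `r` never exceeds the size of the output (`LevelInv.le_numSolutions`); this makes the time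
polynomial in the output.

On the machine side, `Runs` is a Hoare triple with a time bound and a bound `b` on the bits of all
stored numbers. Keys serve as addresses of marks, which is affordable because their bit length is
polynomial and memory starts out zero. The total time is the number of statements times `unitCost
b`. -/

/-- Arithmetic expressions over the registers and the memory arrays. -/
inductive Expr : Type
  | var (x : ℕ)
  | lit (c : ℕ)
  | bin (o : BinOp) (e f : Expr)
  | get (a : ℕ) (e : Expr)

/-- An abstract memory state: finitely many registers and finitely many arrays. -/
structure Store : Type where
  regs : List ℕ
  arrs : List (ℕ → ℕ)

/-- The machine state `σ` agrees with `s`; registers from `20` on are scratch space. -/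
def Store.Models (s : Store) (σ : State) : Prop :=
  s.regs.length ≤ 20 ∧ (∀ x < s.regs.length, σ.reg x = s.regs.getD x 0) ∧
    ∀ a < s.arrs.length, σ.mem a = s.arrs.getD a fun _ => 0

/-- All numbers of `s` have at most `b` bits. -/
def Store.Bounded (b : ℕ) (s : Store) : Prop :=
  2 ≤ b ∧ (∀ v ∈ s.regs, v < 2 ^ b) ∧ ∀ A ∈ s.arrs, ∀ i, A i < 2 ^ b

def Store.setReg (s : Store) (x v : ℕ) : Store :=
  ⟨s.regs.set x v, s.arrs⟩

def Store.setArr (s : Store) (a i v : ℕ) : Store :=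
  ⟨s.regs, s.arrs.set a (Function.update (s.arrs.getD a fun _ => 0) i v)⟩

namespace Expr

def eval (s : Store) : Expr → ℕ
  | var x => s.regs.getD x 0
  | lit c => c
  | bin o e f => o.eval (e.eval s) (f.eval s)
  | get a e => (s.arrs.getD a fun _ => 0) (e.eval s)

def size : Expr → ℕ
  | var _ => 1
  | lit _ => 1
  | bin _ e f => e.size + f.size + 1
  | get _ e => e.size + 1

/-- Only the first `r` registers and the first `a` arrays and small constants occur. -/
def wf (r a : ℕ) : Expr → Bool
  | var x => x < r
  | lit c => c ≤ 3
  | bin _ e f => e.wf r a && f.wf r a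
  | get y e => decide (y < a) && e.wf r a

/-- Evaluation into the register `d`, with the registers from `d` on as scratch space. -/
def code : Expr → ℕ → Prog
  | var x, d => .seq (.const d 0) (.op .add d x d)
  | lit c, d => .const d c
  | bin o e f, d => .seq (e.code d) (.seq (f.code (d + 1)) (.op o d d (d + 1)))
  | get a e, d => .seq (e.code d) (.load d a d)

theorem one_le_size (e : Expr) : 1 ≤ e.size := by
  cases e <;> simp [size]

/-- An operation at most multiplies the bounds of its operands, up to a constant absorbed by the
factor `2 ^ b` of the extra node; `2 ≤ b` also makes room for the literals. A remainder modulo zero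
is the dividend, so it causes no exception. Reading an array brings the bound back to `2 ^ b`. -/
theorem eval_lt {b : ℕ} {s : Store} (hs : s.Bounded b) (e : Expr)
    (he : e.wf s.regs.length s.arrs.length = true) : e.eval s < 2 ^ (b * e.size) := by
  obtain ⟨hb, hr, ha⟩ := hs
  have four : 4 ≤ 2 ^ b := by
    calc 4 = 2 ^ 2 := rfl
      _ ≤ 2 ^ b := Nat.pow_le_pow_right (by norm_num) hb
  induction e with
  | var x =>
    simp only [wf, decide_eq_true_eq] at he
    simp only [eval, size, mul_one, List.getD_eq_getElem _ _ he]
    exact hr _ (List.getElem_mem he)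
  | lit c =>
    simp only [wf, decide_eq_true_eq] at he
    simp only [eval, size, mul_one]
    omega
  | bin o e f ihe ihf =>
    simp only [wf, Bool.and_eq_true] at he
    have h1 := ihe he.1
    have h2 := ihf he.2
    have e1 := one_le_size e
    have e2 := one_le_size f
    have hp : 2 ^ (b * (bin o e f).size) = 2 ^ (b * e.size) * 2 ^ (b * f.size) * 2 ^ b := by
      simp only [size]; ring
    have p1 : 0 < 2 ^ (b * e.size) := by positivity
    have p2 : 0 < 2 ^ (b * f.size) := by positivity
    rw [hp]
    simp only [eval]
    generalize 2 ^ (b * e.size) = X at *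
    generalize 2 ^ (b * f.size) = Y at *
    generalize e.eval s = u at *
    generalize f.eval s = v at *
    have hXY : X ≤ X * Y := Nat.le_mul_of_pos_right _ p2
    have hYX : Y ≤ X * Y := Nat.le_mul_of_pos_left _ p1
    have h4 : X * Y * 4 ≤ X * Y * 2 ^ b := Nat.mul_le_mul_left _ four
    have huv : u * v < X * Y := Nat.mul_lt_mul'' h1 h2
    have hdiv : u / v ≤ u := Nat.div_le_self u v
    have hmod : u % v ≤ u := Nat.mod_le u v
    cases o <;> simp only [BinOp.eval] <;> omega
  | get a e ih =>
    simp only [wf, Bool.and_eq_true, decide_eq_true_eq] at he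
    simp only [eval, size, List.getD_eq_getElem _ _ he.1]
    refine (ha _ (List.getElem_mem he.1) _).trans_le (Nat.pow_le_pow_right (by norm_num) ?_)
    exact Nat.le_mul_of_pos_right _ (by omega)

/-- An upper bound for the charge of a single instruction on values of expressions of size at
most `40`. -/
def stepCost (b : ℕ) : ℕ := (1 + b * 40) ^ 2

theorem opCost_le {b u v : ℕ} (hu : Nat.size u ≤ b * 40) (hv : Nat.size v ≤ b * 40) :
    opCost u v ≤ stepCost b := by
  rw [opCost, stepCost, sq]
  gcongr

theorem accessCost_le {b u v : ℕ} (hu : Nat.size u ≤ b * 40) (hv : Nat.size v ≤ b * 40) :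
    accessCost u v ≤ stepCost b := by
  rw [accessCost, stepCost]
  nlinarith

theorem size_eval_le {b : ℕ} {s : Store} (hs : s.Bounded b) {e : Expr}
    (he : e.wf s.regs.length s.arrs.length = true) (h40 : e.size ≤ 40) :
    Nat.size (e.eval s) ≤ b * 40 :=
  Nat.size_le.2 ((eval_lt hs e he).trans_le
    (Nat.pow_le_pow_right (by norm_num) (Nat.mul_le_mul_left _ h40)))

/-- Registers below `d` are never written, so the value of a left operand can wait in `d` while the
right one is evaluated from `d + 1` on. Each node of the expression costs at most two instructions.
-/
theorem code_exec {b : ℕ} {s : Store} (hs : s.Bounded b) (e : Expr)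
    (he : e.wf s.regs.length s.arrs.length = true) (h40 : e.size ≤ 40)
    (d : ℕ) (hd : 20 ≤ d) (σ : State) (hσ : s.Models σ) :
    ∃ t σ', Exec (e.code d) σ t σ' ∧ σ'.reg d = e.eval s ∧ (∀ x < d, σ'.reg x = σ.reg x) ∧
      σ'.mem = σ.mem ∧ t ≤ 2 * e.size * stepCost b := by
  induction e generalizing d σ with
  | var x =>
    have hsz := size_eval_le hs he h40
    simp only [wf, decide_eq_true_eq] at he
    have hx : x ≠ d := by have := hσ.1; omega
    have hreg := hσ.2.1 x he
    refine ⟨_, _, .seq (.const σ d 0) (.op _ .add d x d), ?_, ?_, rfl, ?_⟩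
    · simp [State.setReg, eval, BinOp.eval, hreg, Function.update_of_ne hx]
    · intro y hy
      simp [State.setReg, Function.update_of_ne hy.ne]
    · have h1 : accessCost 0 0 ≤ stepCost b := accessCost_le (by simp) (by simp)
      have h2 : opCost ((σ.setReg d 0).reg x) ((σ.setReg d 0).reg d) ≤ stepCost b := by
        refine opCost_le ?_ (by simp [State.setReg])
        simpa [State.setReg, Function.update_of_ne hx, hreg, eval] using hsz
      simp only [size]
      omega
  | lit c =>
    have hsz := size_eval_le hs he h40
    refine ⟨_, _, .const σ d c, ?_, ?_, rfl, ?_⟩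
    · simp [State.setReg, eval]
    · intro y hy
      simp [State.setReg, Function.update_of_ne hy.ne]
    · have h1 : accessCost c 0 ≤ stepCost b := accessCost_le hsz (by simp)
      simp only [size]
      omega
  | bin o e f ihe ihf =>
    simp only [wf, Bool.and_eq_true] at he
    simp only [size] at h40
    obtain ⟨t1, σ1, x1, r1, g1, m1, c1⟩ := ihe he.1 (by omega) d hd σ hσ
    have hσ1 : s.Models σ1 := by
      refine ⟨hσ.1, fun x hx => ?_, fun a ha => ?_⟩
      · rw [g1 x (by have := hσ.1; omega), hσ.2.1 x hx]
      · rw [m1, hσ.2.2 a ha]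
    obtain ⟨t2, σ2, x2, r2, g2, m2, c2⟩ := ihf he.2 (by omega) (d + 1) (by omega) σ1 hσ1
    refine ⟨_, _, .seq x1 (.seq x2 (.op _ o d d (d + 1))), ?_, ?_, ?_, ?_⟩
    · simp [State.setReg, eval, r2, g2 d (by omega), r1]
    · intro y hy
      simp [State.setReg, Function.update_of_ne hy.ne, g2 y (by omega), g1 y hy]
    · simp [State.setReg, m1, m2]
    · have h2 : opCost (σ2.reg d) (σ2.reg (d + 1)) ≤ stepCost b := by
        rw [g2 d (by omega), r1, r2]
        exact opCost_le (size_eval_le hs he.1 (by omega)) (size_eval_le hs he.2 (by omega))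
      simp only [size]
      nlinarith
  | get a e ih =>
    have hsz := size_eval_le hs he h40
    simp only [wf, Bool.and_eq_true, decide_eq_true_eq] at he
    simp only [size] at h40
    obtain ⟨t1, σ1, x1, r1, g1, m1, c1⟩ := ih he.2 (by omega) d hd σ hσ
    have hval : σ1.mem a (σ1.reg d) = (get a e).eval s := by
      rw [m1, r1, hσ.2.2 a he.1, eval]
    refine ⟨_, _, .seq x1 (.load _ d a d), ?_, ?_, ?_, ?_⟩
    · simp [State.setReg, hval]
    · intro y hy
      simp [State.setReg, Function.update_of_ne hy.ne, g1 y hy]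
    · simp [State.setReg, m1]
    · have h2 : accessCost (σ1.reg d) (σ1.mem a (σ1.reg d)) ≤ stepCost b := by
        rw [hval, r1]
        exact accessCost_le (size_eval_le hs he.2 (by omega)) hsz
      simp only [size]
      nlinarith

end Expr

/-! ### Structured programs and a logic for their runs -/

open Kemeny.Expr (stepCost)

/-- Evaluate `e` and `f` into the registers `20` and `21`. -/
def evalTwo (e f : Expr) : Prog := .seq (e.code 20) (f.code 21)

/-- `R[x] := e` -/
def assign (x : ℕ) (e : Expr) : Prog :=
  .seq (e.code 20) (.seq (.const 21 0) (.op .add x 20 21))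

/-- `M_a[e] := f` -/
def storeAt (a : ℕ) (e f : Expr) : Prog := .seq (evalTwo e f) (.store a 20 21)

/-- `if e < f then p` -/
def whenLt (e f : Expr) (p : Prog) : Prog := .seq (evalTwo e f) (.ifLt 20 21 p .skip)

/-- `while e < f do p` -/
def loopLt (e f : Expr) (p : Prog) : Prog :=
  .seq (evalTwo e f) (.whileLt 20 21 (.seq p (evalTwo e f)))

/-- The time bound for a single statement. -/
def unitCost (b : ℕ) : ℕ := 200 * stepCost b

/-- Started in `s`, the program `p` halts within `k` units of time in a state that satisfies `Q`;
at the end all numbers have at most `b` bits if that was so at the start. -/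
def Runs (b : ℕ) (p : Prog) (s : Store) (k : ℕ) (Q : Store → Prop) : Prop :=
  s.Bounded b → ∀ σ, s.Models σ → ∃ t s' σ', Exec p σ t σ' ∧ s'.Models σ' ∧ s'.Bounded b ∧
    t ≤ k * unitCost b ∧ Q s'

/-- The expression may be evaluated in the state `s`. -/
def Expr.Fits (e : Expr) (s : Store) : Prop :=
  e.wf s.regs.length s.arrs.length = true ∧ e.size ≤ 40

theorem Store.Models.congr {s : Store} {σ σ' : State} (h : s.Models σ)
    (hr : ∀ x < 20, σ'.reg x = σ.reg x) (hm : σ'.mem = σ.mem) : s.Models σ' :=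
  ⟨h.1, fun x hx => by rw [hr x (hx.trans_le h.1), h.2.1 x hx],
    fun a ha => by rw [hm, h.2.2 a ha]⟩

theorem evalTwo_exec {b : ℕ} {s : Store} (hs : s.Bounded b) {e f : Expr} (he : e.Fits s)
    (hf : f.Fits s) {σ : State} (hσ : s.Models σ) :
    ∃ t σ', Exec (evalTwo e f) σ t σ' ∧ s.Models σ' ∧ σ'.reg 20 = e.eval s ∧
      σ'.reg 21 = f.eval s ∧ t ≤ 160 * stepCost b := by
  obtain ⟨t1, σ1, x1, r1, g1, m1, c1⟩ := Expr.code_exec hs e he.1 he.2 20 le_rfl σ hσ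
  have hσ1 := hσ.congr g1 m1
  obtain ⟨t2, σ2, x2, r2, g2, m2, c2⟩ := Expr.code_exec hs f hf.1 hf.2 21 (by omega) σ1 hσ1
  refine ⟨_, _, .seq x1 x2, hσ1.congr (fun x hx => g2 x (by omega)) m2, ?_, r2, ?_⟩
  · rw [g2 20 (by omega), r1]
  · have h1 := he.2
    have h2 := hf.2
    nlinarith

namespace Runs

variable {b k k' : ℕ} {p q : Prog} {s : Store} {Q Q' : Store → Prop} {e f : Expr}

theorem mono (h : Runs b p s k Q) (hk : k ≤ k') (hQ : ∀ s', Q s' → Q' s') :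
    Runs b p s k' Q' := by
  intro hs σ hσ
  obtain ⟨t, s', σ', hx, hm, hb, ht, hq⟩ := h hs σ hσ
  exact ⟨t, s', σ', hx, hm, hb, ht.trans (Nat.mul_le_mul_right _ hk), hQ s' hq⟩

theorem seq (h : Runs b p s k fun s' => Runs b q s' k' Q) : Runs b (.seq p q) s (k + k') Q := by
  intro hs σ hσ
  obtain ⟨t, s', σ', hx, hm, hb, ht, hq⟩ := h hs σ hσ
  obtain ⟨t', s'', σ'', hx', hm', hb', ht', hq'⟩ := hq hb σ' hm
  exact ⟨_, s'', σ'', .seq hx hx', hm', hb', by rw [add_mul]; omega, hq'⟩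

theorem assign {x : ℕ} (hx : x < s.regs.length) (he : e.Fits s) (hv : e.eval s < 2 ^ b)
    (hQ : Q (s.setReg x (e.eval s))) : Runs b (assign x e) s 1 Q := by
  intro hs σ hσ
  obtain ⟨t1, σ1, x1, r1, g1, m1, c1⟩ := Expr.code_exec hs e he.1 he.2 20 le_rfl σ hσ
  have hx20 : x < 20 := hx.trans_le hσ.1
  refine ⟨_, _, _, .seq x1 (.seq (.const _ 21 0) (.op _ .add x 20 21)), ?_, ?_, ?_, hQ⟩
  · refine ⟨by simpa [Store.setReg] using hσ.1, fun y hy => ?_, fun a ha => ?_⟩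
    · have hy' : y < s.regs.length := by simpa [Store.setReg] using hy
      have hy20 : y < 20 := hy'.trans_le hσ.1
      by_cases hyx : y = x
      · subst hyx
        simp [State.setReg, BinOp.eval, Store.setReg, hy', r1]
      · simp only [State.setReg, Function.update_of_ne hyx, Function.update_of_ne
          (show y ≠ 21 by omega), g1 y hy20, hσ.2.1 y hy', Store.setReg]
        simp [Ne.symm hyx]
    · simp only [State.setReg, m1]
      exact hσ.2.2 a ha
  · refine ⟨hs.1, fun v hv' => ?_, hs.2.2⟩
    rcases List.mem_or_eq_of_mem_set hv' with h | rfl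
    · exact hs.2.1 v h
    · exact hv
  · have h1 : accessCost 0 0 ≤ stepCost b := Expr.accessCost_le (by simp) (by simp)
    have h2 : opCost ((σ1.setReg 21 0).reg 20) ((σ1.setReg 21 0).reg 21) ≤ stepCost b := by
      refine Expr.opCost_le ?_ (by simp [State.setReg])
      simpa [State.setReg, r1] using Expr.size_eval_le hs he.1 he.2
    have h3 := he.2
    simp only [unitCost]
    nlinarith

theorem storeAt {a : ℕ} (ha : a < s.arrs.length) (he : e.Fits s) (hf : f.Fits s)
    (hv : f.eval s < 2 ^ b) (hQ : Q (s.setArr a (e.eval s) (f.eval s))) :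
    Runs b (storeAt a e f) s 1 Q := by
  intro hs σ hσ
  obtain ⟨t1, σ1, x1, m1, r1, r2, c1⟩ := evalTwo_exec hs he hf hσ
  refine ⟨_, _, _, .seq x1 (.store _ a 20 21), ?_, ?_, ?_, hQ⟩
  · refine ⟨m1.1, fun y hy => m1.2.1 y hy, fun c hc => ?_⟩
    have hc' : c < s.arrs.length := by simpa [Store.setArr] using hc
    rw [r1, r2]
    by_cases hca : c = a
    · subst hca
      simp [State.setMem, Store.setArr, hc', m1.2.2 c hc']
    · simp only [State.setMem, Function.update_of_ne hca, m1.2.2 c hc', Store.setArr]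
      simp [Ne.symm hca]
  · refine ⟨hs.1, hs.2.1, fun A hA i => ?_⟩
    rcases List.mem_or_eq_of_mem_set hA with h | rfl
    · exact hs.2.2 A h i
    · by_cases hi : i = e.eval s
      · subst hi; simpa using hv
      · rw [Function.update_of_ne hi, List.getD_eq_getElem _ _ ha]
        exact hs.2.2 _ (List.getElem_mem ha) i
  · have h2 : accessCost (σ1.reg 20) (σ1.reg 21) ≤ stepCost b := by
      rw [r1, r2]
      exact Expr.accessCost_le (Expr.size_eval_le hs he.1 he.2) (Expr.size_eval_le hs hf.1 hf.2)
    simp only [unitCost]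
    nlinarith

theorem whenLt (he : e.Fits s) (hf : f.Fits s) (h : e.eval s < f.eval s → Runs b p s k Q)
    (h' : ¬ e.eval s < f.eval s → Q s) : Runs b (whenLt e f p) s (k + 1) Q := by
  intro hs σ hσ
  obtain ⟨t1, σ1, x1, m1, r1, r2, c1⟩ := evalTwo_exec hs he hf hσ
  have h2 : accessCost (σ1.reg 20) (σ1.reg 21) ≤ stepCost b := by
    rw [r1, r2]
    exact Expr.accessCost_le (Expr.size_eval_le hs he.1 he.2) (Expr.size_eval_le hs hf.1 hf.2)
  have h3 : 1 ≤ stepCost b := Nat.one_le_pow _ _ (by omega)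
  by_cases hlt : e.eval s < f.eval s
  · obtain ⟨t, s', σ', hx, hm, hb, ht, hq⟩ := h hlt hs σ1 m1
    refine ⟨_, s', σ', .seq x1 (.ifTrue (by rwa [r1, r2]) hx), hm, hb, ?_, hq⟩
    rw [add_mul]
    simp only [unitCost] at *
    omega
  · refine ⟨_, s, σ1, .seq x1 (.ifFalse (by rwa [r1, r2]) (.skip σ1)), m1, hs, ?_, h' hlt⟩
    rw [add_mul]
    simp only [unitCost]
    have : 0 ≤ k * (200 * stepCost b) := Nat.zero_le _
    omega

/-- The index of the invariant counts completed rounds. That it stays below `n` is part of the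
preservation step, so a bound on the rounds may be derived from the invariant itself, as the search
needs. The two extra units per round pay for the comparison and the renewed evaluation of the
condition. -/
theorem loopLt (I : ℕ → Store → Prop) (n : ℕ) (h0 : I 0 s)
    (hfit : ∀ i s, I i s → e.Fits s ∧ f.Fits s)
    (hstep : ∀ i s, s.Bounded b → I i s → e.eval s < f.eval s →
      i < n ∧ Runs b p s k (I (i + 1)))
    (hexit : ∀ i s, I i s → ¬ e.eval s < f.eval s → Q s) :
    Runs b (loopLt e f p) s (n * (k + 2) + 2) Q := by
  have key : ∀ d i, n - i ≤ d → ∀ s σ, I i s → s.Bounded b → s.Models σ →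
      σ.reg 20 = e.eval s → σ.reg 21 = f.eval s →
      ∃ t s' σ', Exec (.whileLt 20 21 (.seq p (evalTwo e f))) σ t σ' ∧ s'.Models σ' ∧
        s'.Bounded b ∧ t ≤ (d * (k + 2) + 1) * unitCost b ∧ Q s' := by
    intro d
    induction d with
    | zero =>
      intro i hi s σ hI hs hσ r1 r2
      obtain ⟨he, hf⟩ := hfit i s hI
      have hn : ¬ e.eval s < f.eval s := fun hlt => by
        have := (hstep i s hs hI hlt).1
        omega
      have h2 : accessCost (σ.reg 20) (σ.reg 21) ≤ stepCost b := by
        rw [r1, r2]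
        exact Expr.accessCost_le (Expr.size_eval_le hs he.1 he.2)
          (Expr.size_eval_le hs hf.1 hf.2)
      refine ⟨_, s, σ, .whileFalse (by rwa [r1, r2]), hσ, hs, ?_, hexit i s hI hn⟩
      simp only [unitCost]
      omega
    | succ d ih =>
      intro i hi s σ hI hs hσ r1 r2
      obtain ⟨he, hf⟩ := hfit i s hI
      have h2 : accessCost (σ.reg 20) (σ.reg 21) ≤ stepCost b := by
        rw [r1, r2]
        exact Expr.accessCost_le (Expr.size_eval_le hs he.1 he.2)
          (Expr.size_eval_le hs hf.1 hf.2)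
      by_cases hlt : e.eval s < f.eval s
      · obtain ⟨hin, hrun⟩ := hstep i s hs hI hlt
        obtain ⟨t, s', σ', hx, hm, hb, ht, hq⟩ := hrun hs σ hσ
        obtain ⟨he', hf'⟩ := hfit _ s' hq
        obtain ⟨t1, σ1, x1, m1, r1', r2', c1⟩ := evalTwo_exec hb he' hf' hm
        obtain ⟨t2, s2, σ2, hx2, hm2, hb2, ht2, hq2⟩ :=
          ih (i + 1) (by omega) s' σ1 hq hb m1 r1' r2'
        refine ⟨_, s2, σ2, .whileTrue (by rwa [r1, r2]) (.seq hx x1) hx2, hm2, hb2, ?_, hq2⟩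
        have : ((d + 1) * (k + 2) + 1) * unitCost b
            = (d * (k + 2) + 1) * unitCost b + k * unitCost b + 2 * unitCost b := by ring
        rw [this]
        simp only [unitCost] at *
        omega
      · refine ⟨_, s, σ, .whileFalse (by rwa [r1, r2]), hσ, hs, ?_, hexit i s hI hlt⟩
        have : stepCost b ≤ ((d + 1) * (k + 2) + 1) * unitCost b := by
          simp only [unitCost]
          nlinarith [Nat.zero_le ((d + 1) * (k + 2) * (200 * stepCost b))]
        omega
  intro hs σ hσ
  obtain ⟨he, hf⟩ := hfit 0 s h0
  obtain ⟨t1, σ1, x1, m1, r1, r2, c1⟩ := evalTwo_exec hs he hf hσ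
  obtain ⟨t2, s2, σ2, hx2, hm2, hb2, ht2, hq2⟩ := key n 0 (by omega) s σ1 h0 hs m1 r1 r2
  refine ⟨_, s2, σ2, .seq x1 hx2, hm2, hb2, ?_, hq2⟩
  have : (n * (k + 2) + 2) * unitCost b = (n * (k + 2) + 1) * unitCost b + unitCost b := by ring
  rw [this]
  simp only [unitCost] at *
  omega

end Runs

/-! ### Paths: reversed prefixes of rankings

A prefix of a ranking is stored as a list with the candidate ranked last at its head. -/

section Paths

variable {m n : ℕ}

/-- The number of votes that prefer `a` to `b`. -/
def votes (V : Profile m n) (a b : Fin m) : ℕ :=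
  (Finset.univ.filter fun i : Fin n => V i a < V i b).card

/-- The contribution to the Kemeny score of the pairs within a reversed prefix. -/
def cost (V : Profile m n) : List (Fin m) → ℕ
  | [] => 0
  | c :: p => cost V p + (p.map (votes V c)).sum

/-- The set of the candidates of a list as a bit mask. -/
def mask (p : List (Fin m)) : ℕ := (p.map fun c : Fin m => 2 ^ (c : ℕ)).sum

/-- A number that stands for the set of the candidates in `p` and the cost of `p`. -/
def key (V : Profile m n) (p : List (Fin m)) : ℕ := mask p + (1 + cost V p) * 2 ^ m

/-- Every candidate comes after all candidates that all votes prefer to it. -/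
def IsPath (V : Profile m n) : List (Fin m) → Prop
  | [] => True
  | c :: p => IsPath V p ∧ c ∉ p ∧ ∀ a, a ∉ p → votes V a c < n

/-- The `a`-th binary digit. -/
def bit (x a : ℕ) : ℕ := x / 2 ^ a % 2

/-- The cost of appending `c` to a prefix with key `x`. -/
def addCost (V : Profile m n) (x : ℕ) (c : Fin m) : ℕ := ∑ a : Fin m, bit x a * votes V c a

/-- Positive iff `c` must not be appended to a prefix with key `x`. -/
def defect (V : Profile m n) (x : ℕ) (c : Fin m) : ℕ :=
  bit x c + ∑ a : Fin m, (1 - bit x a) * (votes V a c / n)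

theorem votes_le (V : Profile m n) (a b : Fin m) : votes V a b ≤ n := by
  simpa [votes] using Finset.card_filter_le (Finset.univ : Finset (Fin n)) _

theorem votes_eq_iff (V : Profile m n) (a b : Fin m) :
    votes V a b = n ↔ ∀ i, V i a < V i b := by
  have := Finset.card_filter_eq_iff (s := (Finset.univ : Finset (Fin n)))
    (p := fun i => V i a < V i b)
  simpa [votes] using this

theorem mask_eq_sum {p : List (Fin m)} (hp : p.Nodup) :
    mask p = ∑ i ∈ p.toFinset.map Fin.valEmbedding, 2 ^ i := by
  rw [mask, ← List.sum_toFinset _ hp, Finset.sum_map]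
  rfl

theorem mask_lt {p : List (Fin m)} (hp : p.Nodup) : mask p < 2 ^ m := by
  rw [mask_eq_sum hp]
  refine Nat.geomSum_lt le_rfl fun k hk => ?_
  obtain ⟨c, -, rfl⟩ := Finset.mem_map.1 hk
  exact c.2

theorem mask_full {p : List (Fin m)} (hp : p.Nodup) (hc : ∀ c, c ∈ p) :
    mask p = 2 ^ m - 1 := by
  have : p.toFinset.map Fin.valEmbedding = Finset.range m := by
    ext i
    simp only [Finset.mem_map, List.mem_toFinset, Finset.mem_range]
    exact ⟨fun ⟨c, _, h⟩ => h ▸ c.2, fun h => ⟨⟨i, h⟩, hc _, rfl⟩⟩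
  rw [mask_eq_sum hp, this]
  simpa using Nat.geomSum_eq (le_refl 2) m

theorem testBit_mask {p : List (Fin m)} (hp : p.Nodup) (a : Fin m) :
    (mask p).testBit a = decide (a ∈ p) := by
  have h := Finset.toFinset_bitIndices_sum_two_pow (p.toFinset.map Fin.valEmbedding)
  rw [← mask_eq_sum hp] at h
  have h' : (a : ℕ) ∈ (mask p).bitIndices.toFinset ↔ a ∈ p := by
    rw [h]
    simp [Fin.val_inj]
  rw [List.mem_toFinset, Nat.mem_bitIndices] at h'
  rw [Bool.eq_iff_iff, h', decide_eq_true_iff]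

theorem bit_le_one (x a : ℕ) : bit x a ≤ 1 := by
  have := Nat.mod_lt (x / 2 ^ a) two_pos
  rw [bit]
  omega

/-- Because `mask p < 2 ^ m`, a multiple of `2 ^ m` does not disturb the low digits: membership can
be read off a key whatever cost is stored above. -/
theorem bit_mask {p : List (Fin m)} (hp : p.Nodup) (k : ℕ) (a : Fin m) :
    bit (mask p + k * 2 ^ m) a = if a ∈ p then 1 else 0 := by
  have h := Nat.testBit_two_pow_mul_add k (mask_lt hp) a
  rw [if_pos a.2, testBit_mask hp, Nat.testBit_eq_decide_div_mod_eq, mul_comm, add_comm] at h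
  have h2 := bit_le_one (mask p + k * 2 ^ m) a
  have h3 : bit (mask p + k * 2 ^ m) a = 1 ↔ a ∈ p := by
    rw [bit, ← decide_eq_true_iff (p := a ∈ p), ← h, decide_eq_true_iff]
  split_ifs with hap
  · exact h3.2 hap
  · have h4 : bit (mask p + k * 2 ^ m) a ≠ 1 := fun h => hap (h3.1 h)
    omega

theorem addCost_mask (V : Profile m n) {p : List (Fin m)} (hp : p.Nodup) (k : ℕ) (c : Fin m) :
    addCost V (mask p + k * 2 ^ m) c = (p.map (votes V c)).sum := by
  rw [addCost, ← List.sum_toFinset _ hp]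
  simp only [bit_mask hp, ite_mul, one_mul, zero_mul]
  rw [← Finset.sum_filter]
  congr 1
  ext a
  simp

/-- For positive `n` the integer quotient `votes V a c / n` vanishes exactly when the preference is
not unanimous, which turns the test into arithmetic. -/
theorem defect_mask (V : Profile m n) (hn : 0 < n) {p : List (Fin m)} (hp : p.Nodup) (k : ℕ)
    (c : Fin m) :
    defect V (mask p + k * 2 ^ m) c = 0 ↔ c ∉ p ∧ ∀ a, a ∉ p → votes V a c < n := by
  rw [defect, Nat.add_eq_zero_iff, Finset.sum_eq_zero_iff]
  simp only [bit_mask hp, Finset.mem_univ, true_imp_iff]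
  refine and_congr (by simp) (forall_congr' fun a => ?_)
  by_cases ha : a ∈ p
  · simp [ha]
  · simp [ha, hn.ne']

theorem IsPath.nodup {V : Profile m n} {p : List (Fin m)} (h : IsPath V p) : p.Nodup := by
  induction p with
  | nil => exact List.nodup_nil
  | cons c p ih => exact List.nodup_cons.2 ⟨h.2.1, ih h.1⟩

theorem isPath_cons_iff {V : Profile m n} (hn : 0 < n) {p : List (Fin m)} (h : IsPath V p)
    (c : Fin m) : IsPath V (c :: p) ↔ defect V (key V p) c = 0 := by
  rw [key, defect_mask V hn h.nodup]
  simp [IsPath, h]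

theorem key_cons (V : Profile m n) {p : List (Fin m)} (hp : p.Nodup) (c : Fin m) :
    key V (c :: p) = key V p + 2 ^ (c : ℕ) + addCost V (key V p) c * 2 ^ m := by
  rw [key, key, addCost_mask V hp]
  simp only [mask, cost, List.map_cons, List.sum_cons]
  ring

theorem key_nil (V : Profile m n) : key V [] = 2 ^ m := by simp [key, mask, cost]

theorem key_eq_of_perm {V : Profile m n} {p q : List (Fin m)} (h : p.Perm q)
    (hc : cost V p = cost V q) : key V p = key V q := by
  rw [key, key, hc, mask, mask, (h.map _).sum_eq]

/-- What a candidate adds to the cost depends only on the set of candidates before it, so `s` adds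
the same amount to `p` and to `q`. The additive form avoids truncated subtraction. -/
theorem cost_append_add {V : Profile m n} {p q : List (Fin m)} (h : p.Perm q)
    (s : List (Fin m)) : cost V (s ++ p) + cost V q = cost V (s ++ q) + cost V p := by
  induction s with
  | nil => simp [add_comm]
  | cons c s ih =>
    have : ((s ++ p).map (votes V c)).sum = ((s ++ q).map (votes V c)).sum :=
      ((h.append_left s).map _).sum_eq
    simp only [List.cons_append, cost, this]
    omega

theorem cost_le (V : Profile m n) (p : List (Fin m)) : cost V p ≤ p.length * p.length * n := by
  induction p with
  | nil => simp [cost]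
  | cons c p ih =>
    have : (p.map (votes V c)).sum ≤ p.length * n := by
      refine (List.sum_le_card_nsmul _ n fun x hx => ?_).trans (by simp)
      obtain ⟨a, -, rfl⟩ := List.mem_map.1 hx
      exact votes_le V c a
    simp only [cost, List.length_cons]
    nlinarith [Nat.zero_le ((p.length + 1) * n)]

theorem cost_le_of_nodup (V : Profile m n) {p : List (Fin m)} (hp : p.Nodup) :
    cost V p ≤ m * m * n := by
  have hl : p.length ≤ m := by simpa using hp.length_le_card
  exact (cost_le V p).trans (by gcongr)

/-! ### Rankings as complete paths -/

/-- A ranking as a list, the least preferred candidate first. -/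
def revList (Q : Ranking m) : List (Fin m) := (List.ofFn Q.symm).reverse

theorem nodup_revList (Q : Ranking m) : (revList Q).Nodup := by
  rw [revList, List.nodup_reverse, List.nodup_ofFn]
  exact Q.symm.injective

theorem mem_revList (Q : Ranking m) (c : Fin m) : c ∈ revList Q := by
  rw [revList, List.mem_reverse, List.mem_ofFn]
  exact Q.symm.surjective c

theorem pairwise_revList (Q : Ranking m) : (revList Q).Pairwise fun b a => Q a < Q b := by
  rw [revList, List.pairwise_reverse, List.pairwise_ofFn]
  intro i j hij
  simpa using hij

theorem exists_revList_eq {L : List (Fin m)} (hL : L.Nodup) (hc : ∀ c, c ∈ L) :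
    ∃ Q : Ranking m, revList Q = L := by
  have hlen : L.reverse.length = m := by
    have := Fintype.card_congr (hL.getEquivOfForallMemList L hc)
    simpa using this
  let e := List.Nodup.getEquivOfForallMemList L.reverse (List.nodup_reverse.2 hL)
    (fun c => List.mem_reverse.2 (hc c))
  refine ⟨((finCongr hlen).symm.trans e).symm, ?_⟩
  rw [revList, List.reverse_eq_iff]
  apply List.ext_getElem
  · rw [List.length_ofFn, hlen]
  · intro i h1 h2
    simp [e]

theorem cost_eq_sum (V : Profile m n) (Q : Ranking m) {p : List (Fin m)}
    (hp : p.Pairwise fun b a => Q a < Q b) :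
    cost V p = ∑ b ∈ p.toFinset, ∑ a ∈ p.toFinset, if Q a < Q b then votes V b a else 0 := by
  induction p with
  | nil => simp [cost]
  | cons c p ih =>
    obtain ⟨hc, hp'⟩ := List.pairwise_cons.1 hp
    have hcp : c ∉ p := fun h => lt_irrefl _ (hc c h)
    have hnd : p.Nodup := hp'.imp fun {a b} h => by rintro rfl; exact lt_irrefl _ h
    have hcf : c ∉ p.toFinset := by simpa using hcp
    rw [cost, ih hp', List.toFinset_cons, Finset.sum_insert hcf, Finset.sum_insert hcf,
      if_neg (lt_irrefl _), zero_add, ← List.sum_toFinset _ hnd, add_comm]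
    congr 1
    · refine Finset.sum_congr rfl fun a ha => ?_
      rw [if_pos (hc a (List.mem_toFinset.1 ha))]
    · refine Finset.sum_congr rfl fun b hb => ?_
      rw [Finset.sum_insert hcf, if_neg (hc b (List.mem_toFinset.1 hb)).asymm, zero_add]

theorem ktDist_eq_sum (Q v : Ranking m) :
    ktDist Q v = ∑ a, ∑ b, if Q a < Q b ∧ v b < v a then 1 else 0 := by
  rw [ktDist, Finset.card_filter, Fintype.sum_prod_type]
  rfl

/-- Both sides count the triples of a vote and two candidates on which `Q` and the vote disagree,
grouped by pairs on the left and by votes on the right. -/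
theorem cost_revList (V : Profile m n) (Q : Ranking m) :
    cost V (revList Q) = kemenyScore V Q := by
  have huniv : (revList Q).toFinset = Finset.univ := by
    ext c
    simp [mem_revList]
  rw [cost_eq_sum V Q (pairwise_revList Q), huniv, kemenyScore]
  simp only [ktDist_eq_sum, votes, Finset.card_filter]
  rw [Finset.sum_comm, Finset.sum_comm (s := (Finset.univ : Finset (Fin n)))]
  refine Finset.sum_congr rfl fun a _ => ?_
  rw [Finset.sum_comm (s := (Finset.univ : Finset (Fin n)))]
  refine Finset.sum_congr rfl fun b _ => ?_
  by_cases h : Q a < Q b <;> simp [h]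

/-! ### Unanimous preferences hold in all Kemeny rankings -/

/-- Swapping two candidates `b`, `a` which `Q` orders differently from `v` moves `Q` closer
to `v`. -/
theorem ktDist_swap_lt (Q v : Ranking m) {a b : Fin m} (hv : v a < v b) (hQ : Q b < Q a) :
    ktDist ((Equiv.swap a b).trans Q) v < ktDist Q v := by
  have hab : a ≠ b := by rintro rfl; exact lt_irrefl _ hv
  have hmem : ∀ (R : Ranking m) (p : Fin m × Fin m), p ∈ (Finset.univ.filter
      fun p : Fin m × Fin m => prefers R p.1 p.2 ∧ prefers v p.2 p.1) ↔
      R p.1 < R p.2 ∧ v p.2 < v p.1 :=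
    fun R p => Finset.mem_filter.trans ⟨fun h => h.2, fun h => ⟨Finset.mem_univ _, h⟩⟩
  rw [ktDist, ktDist, ← Finset.card_erase_add_one ((hmem Q (b, a)).2 ⟨hQ, hv⟩), Nat.lt_succ_iff]
  have hs : ∀ x, (Equiv.swap a b) x = if x = a then b else if x = b then a else x :=
    fun x => Equiv.swap_apply_def a b x
  have hinj : ∀ x y, Q x = Q y → x = y := fun x y h => Q.injective h
  -- A pair that only the swap makes discordant consists of `a` or `b` and some `z` between them in
  -- `Q`. A new `(a, z)` is charged to `(b, z)` and a new `(z, b)` to `(z, a)`, which were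
  -- discordant before and no longer are. All other pairs stay fixed, and `(b, a)` is never hit,
  -- hence the strict inequality.
  refine Finset.card_le_card_of_injOn (fun p =>
    if p.1 = a ∧ Q p.2 < Q a then (b, p.2) else if p.2 = b ∧ Q b < Q p.1 then (p.1, a) else p)
    ?_ ?_
  · rintro ⟨x, y⟩ h
    rw [Finset.mem_coe, hmem, Equiv.trans_apply, Equiv.trans_apply, hs, hs] at h
    rw [Finset.mem_coe, Finset.mem_erase, hmem]
    clear hmem hs
    grind
  · rintro ⟨x, y⟩ h ⟨x', y'⟩ h'
    rw [Finset.mem_coe, hmem, Equiv.trans_apply, Equiv.trans_apply, hs, hs] at h h'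
    clear hmem hs
    grind

theorem lt_of_votes_eq (hn : 0 < n) {V : Profile m n} {Q : Ranking m}
    (hQ : Q ∈ kemenyRankings V) {a b : Fin m} (h : votes V a b = n) : Q a < Q b := by
  rw [votes_eq_iff] at h
  by_contra hlt
  have hab : a ≠ b := by rintro rfl; exact lt_irrefl _ (h ⟨0, hn⟩)
  have hba : Q b < Q a := lt_of_le_of_ne (not_lt.1 hlt) fun e => hab (Q.injective e.symm)
  have hmin := (Finset.mem_filter.1 hQ).2 ((Equiv.swap a b).trans Q)
  refine absurd hmin (not_le.2 ?_)
  refine Finset.sum_lt_sum_of_nonempty ⟨⟨0, hn⟩, Finset.mem_univ _⟩ fun i _ => ?_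
  exact ktDist_swap_lt Q (V i) (h i) hba

/-- Complete lists of minimum cost. -/
def IsOptimal (V : Profile m n) (L : List (Fin m)) : Prop :=
  L.Nodup ∧ (∀ c, c ∈ L) ∧ ∀ Q : Ranking m, cost V L ≤ kemenyScore V Q

theorem isOptimal_revList_iff (V : Profile m n) (Q : Ranking m) :
    IsOptimal V (revList Q) ↔ Q ∈ kemenyRankings V := by
  simp [IsOptimal, kemenyRankings, nodup_revList, mem_revList, cost_revList]

theorem IsOptimal.exists_ranking {V : Profile m n} {L : List (Fin m)} (h : IsOptimal V L) :
    ∃ Q ∈ kemenyRankings V, revList Q = L := by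
  obtain ⟨Q, rfl⟩ := exists_revList_eq h.1 h.2.1
  exact ⟨Q, (isOptimal_revList_iff V Q).1 h, rfl⟩

/-- A candidate not yet placed when `c` is appended is `c` itself or ranked after `c`; in a Kemeny
ranking it cannot be preferred to `c` by all votes. -/
theorem isPath_of_isOptimal (hn : 0 < n) {V : Profile m n} {s p : List (Fin m)}
    (h : IsOptimal V (s ++ p)) : IsPath V p := by
  induction p generalizing s with
  | nil => trivial
  | cons c p ih =>
    obtain ⟨Q, hQ, hL⟩ := h.exists_ranking
    refine ⟨ih (s := s ++ [c]) (by simpa using h), fun hc => ?_, fun a ha => ?_⟩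
    · exact (List.nodup_cons.1 h.1.of_append_right).1 hc
    · refine lt_of_le_of_ne (votes_le V a c) fun heq => ?_
      have hlt := lt_of_votes_eq hn hQ heq
      have hmem := h.2.1 a
      simp only [List.mem_append, List.mem_cons, ha, or_false] at hmem
      rcases hmem with hs | rfl
      · have hpw := pairwise_revList Q
        rw [hL, List.pairwise_append] at hpw
        exact (hpw.2.2 a hs c (by simp)).asymm hlt
      · exact lt_irrefl _ hlt

theorem exists_isOptimal (V : Profile m n) : ∃ L, IsOptimal V L := by
  obtain ⟨Q, -, hQ⟩ := Finset.exists_min_image (Finset.univ : Finset (Ranking m))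
    (kemenyScore V) ⟨1, Finset.mem_univ _⟩
  exact ⟨revList Q, (isOptimal_revList_iff V Q).2 (by simpa [kemenyRankings] using hQ)⟩

theorem IsOptimal.congr {V : Profile m n} {s p q : List (Fin m)} (h : IsOptimal V (s ++ p))
    (hpq : p.Perm q) (hc : cost V p = cost V q) : IsOptimal V (s ++ q) := by
  have hperm := hpq.append_left s
  have := cost_append_add (V := V) hpq s
  refine ⟨hperm.nodup_iff.1 h.1, fun c => hperm.mem_iff.1 (h.2.1 c), fun Q => ?_⟩
  have := h.2.2 Q
  omega

/-- Each completion is at least as cheap as the other. Hence a suffix alone determines the key of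
the prefix that it leaves. -/
theorem IsOptimal.cost_eq {V : Profile m n} {s p q : List (Fin m)} (hp : IsOptimal V (s ++ p))
    (hq : IsOptimal V (s ++ q)) : p.Perm q ∧ cost V p = cost V q := by
  have hperm : p.Perm q := by
    have : (s ++ p).Perm (s ++ q) :=
      (List.perm_ext_iff_of_nodup hp.1 hq.1).2 fun c => by simp only [hp.2.1, hq.2.1]
    exact (List.perm_append_left_iff s).1 this
  refine ⟨hperm, ?_⟩
  have := cost_append_add (V := V) hperm s
  obtain ⟨Q, -, hQ⟩ := hp.exists_ranking
  obtain ⟨Q', -, hQ'⟩ := hq.exists_ranking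
  have h1 := hp.2.2 Q'
  have h2 := hq.2.2 Q
  rw [← cost_revList, hQ'] at h1
  rw [← cost_revList, hQ] at h2
  omega

end Paths

section Counting

variable {m n : ℕ}

/-! ### The number of keys of paths -/

theorem IsPath.votes_lt {V : Profile m n} {p : List (Fin m)} (h : IsPath V p) {a c : Fin m}
    (hc : c ∈ p) (ha : a ∉ p) : votes V a c < n := by
  induction p with
  | nil => simp at hc
  | cons d p ih =>
    rw [List.mem_cons, not_or] at ha
    rcases List.mem_cons.1 hc with rfl | hc
    · exact h.2.2 a ha.2
    · exact ih h.1 hc ha.2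

theorem pos_lt_pos_add_maxRange (V : Profile m n) (i j : Fin n) (c : Fin m) :
    (V i c : ℕ) < V j c + maxRange V := by
  have h1 : range V c ≤ maxRange V := Finset.le_sup (f := fun c => range V c) (Finset.mem_univ c)
  have h2 := Finset.le_sup (f := fun p : Fin n × Fin n =>
    ((pos (V p.1) c : ℤ) - (pos (V p.2) c : ℤ)).natAbs) (Finset.mem_univ (i, j))
  simp only [pos_eq] at h2
  rw [range] at h1
  simp only [pos_eq] at h1
  omega

/-- One `maxRange V` is spent on moving `a` from vote `i` to another vote and one on moving `c`:
with a larger gap, `a` would precede `c` in every vote. -/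
theorem IsPath.pos_lt {V : Profile m n} {p : List (Fin m)} (h : IsPath V p) (i : Fin n)
    {a c : Fin m} (hc : c ∈ p) (ha : a ∉ p) : (V i c : ℕ) < V i a + 2 * maxRange V := by
  by_contra hlt
  refine (h.votes_lt hc ha).ne ((votes_eq_iff V a c).2 fun j => ?_)
  have h1 := pos_lt_pos_add_maxRange V j i a
  have h2 := pos_lt_pos_add_maxRange V i j c
  exact Fin.lt_def.2 (by omega)

/-- The candidates of a path are an initial segment of a vote `i` and some of the following
`2 * maxRange V` candidates in that vote. -/
theorem IsPath.exists_window {V : Profile m n} {p : List (Fin m)} (h : IsPath V p) (i : Fin n) :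
    ∃ x ∈ Finset.range (m + 1), ∃ U ∈ (Finset.range (2 * maxRange V)).powerset,
      p.toFinset = Finset.univ.filter
        fun c => (V i c : ℕ) < x ∨ x ≤ (V i c : ℕ) ∧ (V i c : ℕ) - x ∈ U := by
  by_cases hall : ∀ c, c ∈ p
  · refine ⟨m, by simp, ∅, by simp, ?_⟩
    ext c
    simp [hall c]
  · push Not at hall
    -- The first candidate of vote `i` outside the path: all earlier ones belong to it, so the place
    -- of `a` is the cut.
    obtain ⟨a, ha, hmin⟩ := Finset.exists_min_image (Finset.univ.filter fun a => a ∉ p)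
      (fun a => (V i a : ℕ)) (by obtain ⟨a, ha⟩ := hall; exact ⟨a, by simpa using ha⟩)
    simp only [Finset.mem_filter, Finset.mem_univ, true_and] at ha hmin
    refine ⟨V i a, Finset.mem_range.2 (by omega),
      (Finset.range (2 * maxRange V)).filter fun u => ∃ c ∈ p, (V i c : ℕ) = V i a + u,
      Finset.mem_powerset.2 (Finset.filter_subset _ _), ?_⟩
    ext c
    simp only [List.mem_toFinset, Finset.mem_filter, Finset.mem_univ, true_and, Finset.mem_range]
    constructor
    · intro hc
      have := h.pos_lt i hc ha
      by_cases hlt : (V i c : ℕ) < V i a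
      · exact Or.inl hlt
      · exact Or.inr ⟨by omega, by omega, c, hc, by omega⟩
    · rintro (hlt | ⟨hle, -, c', hc', he⟩)
      · by_contra hc
        have := hmin c hc
        omega
      · have : V i c' = V i c := Fin.ext (by omega)
        rwa [← (V i).injective this]

/-- A bound for the number of keys of paths. -/
def nodeBound (V : Profile m n) : ℕ := (m + 1) * 2 ^ (2 * maxRange V) * (m * m * n + 1)

theorem card_le_nodeBound (hn : 0 < n) (V : Profile m n) (s : Finset ℕ)
    (hs : ∀ x ∈ s, ∃ p, IsPath V p ∧ key V p = x) : s.card ≤ nodeBound V := by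
  let i : Fin n := ⟨0, hn⟩
  let T := (Finset.range (m + 1) ×ˢ (Finset.range (2 * maxRange V)).powerset) ×ˢ
    Finset.range (m * m * n + 1)
  let f : (ℕ × Finset ℕ) × ℕ → ℕ := fun q =>
    (∑ c ∈ Finset.univ.filter (fun c : Fin m =>
      (V i c : ℕ) < q.1.1 ∨ q.1.1 ≤ (V i c : ℕ) ∧ (V i c : ℕ) - q.1.1 ∈ q.1.2), 2 ^ (c : ℕ))
      + (1 + q.2) * 2 ^ m
  have hsub : s ⊆ T.image f := by
    intro x hx
    obtain ⟨p, hp, rfl⟩ := hs x hx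
    obtain ⟨x, hx, U, hU, hpU⟩ := hp.exists_window i
    refine Finset.mem_image.2 ⟨((x, U), cost V p), ?_, ?_⟩
    · simp only [T, Finset.mem_product]
      exact ⟨⟨hx, hU⟩, Finset.mem_range.2 (Nat.lt_succ_of_le (cost_le_of_nodup V hp.nodup))⟩
    · simp only [f]
      rw [← hpU, List.sum_toFinset _ hp.nodup]
      rfl
  calc s.card ≤ (T.image f).card := Finset.card_le_card hsub
    _ ≤ T.card := Finset.card_image_le
    _ = nodeBound V := by simp [T, nodeBound]

theorem key_lt (V : Profile m n) {p : List (Fin m)} (hp : p.Nodup) :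
    key V p < (m * m * n + 2) * 2 ^ m := by
  have h1 := mask_lt hp
  have h2 : (1 + cost V p) * 2 ^ m ≤ (m * m * n + 1) * 2 ^ m := by
    have := cost_le_of_nodup V hp
    exact Nat.mul_le_mul_right _ (by omega)
  rw [key]
  linarith

/-! ### Closure: a set of keys closed under one-step extensions contains all keys of paths -/

theorem forall_isPath_of_closed (hn : 0 < n) (V : Profile m n) (A : ℕ → Prop) (h0 : A (2 ^ m))
    (hA : ∀ x, A x → ∀ c : Fin m, defect V x c = 0 →
      A (x + 2 ^ (c : ℕ) + addCost V x c * 2 ^ m)) {p : List (Fin m)} (hp : IsPath V p) :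
    A (key V p) := by
  induction p with
  | nil => rwa [key_nil]
  | cons c p ih =>
    rw [key_cons V hp.1.nodup]
    exact hA _ (ih hp.1) c ((isPath_cons_iff hn hp.1 c).1 hp)

/-! ### The first complete key, and predecessors -/

theorem key_of_isOptimal {V : Profile m n} {L : List (Fin m)} (h : IsOptimal V L) :
    key V L = 2 ^ m - 1 + (1 + cost V L) * 2 ^ m := by
  rw [key, mask_full h.1 h.2.1]

/-- An optimal complete list is itself a path, so if it were cheaper than `p` its key would
contradict minimality of `k`. -/
theorem isOptimal_of_first (hn : 0 < n) {V : Profile m n} {p : List (Fin m)} (hp : IsPath V p)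
    {k : ℕ} (hk : key V p = 2 ^ m - 1 + (1 + k) * 2 ^ m)
    (hfirst : ∀ k' < k, ¬ ∃ p, IsPath V p ∧ key V p = 2 ^ m - 1 + (1 + k') * 2 ^ m) :
    IsOptimal V p := by
  have hpow : 0 < 2 ^ m := by positivity
  have hmask : mask p = 2 ^ m - 1 := by
    have h' := congrArg (· % 2 ^ m) hk
    simpa [key, Nat.mod_eq_of_lt (mask_lt hp.nodup), Nat.mod_eq_of_lt (Nat.sub_lt hpow one_pos)]
      using h'
  have hcost : cost V p = k := by
    rw [key, hmask] at hk
    have := Nat.eq_of_mul_eq_mul_right hpow (Nat.add_left_cancel hk)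
    omega
  refine ⟨hp.nodup, fun c => ?_, fun Q => ?_⟩
  · have := testBit_mask hp.nodup c
    rw [hmask, Nat.testBit_two_pow_sub_one] at this
    simpa using this.symm
  · obtain ⟨L, hL⟩ := exists_isOptimal V
    refine le_trans ?_ (hL.2.2 Q)
    by_contra hlt
    exact hfirst (cost V L) (by omega)
      ⟨L, isPath_of_isOptimal (s := []) hn hL, key_of_isOptimal hL⟩

/-- The key before the candidate `c` was appended. -/
def prevKey (V : Profile m n) (x : ℕ) (c : Fin m) : ℕ :=
  x - 2 ^ (c : ℕ) - addCost V (x - 2 ^ (c : ℕ)) c * 2 ^ m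

/-- A predecessor key only provides some path `q`, not `p` without `c`. Comparing the two parts of
the keys shows that `c :: q` has the candidates and the cost of `p`, so it may replace `p`. -/
theorem IsOptimal.extend {V : Profile m n} {s p q : List (Fin m)} {c : Fin m}
    (h : IsOptimal V (s ++ p)) (hp : IsPath V p) (hc : bit (key V p) c = 1) (hq : IsPath V q)
    (hk : key V q = prevKey V (key V p) c) : IsOptimal V (s ++ [c] ++ q) := by
  have hcp : c ∈ p := by
    by_contra hcp
    rw [key, bit_mask hp.nodup, if_neg hcp] at hc
    omega
  have hpe := List.perm_cons_erase hcp
  have hnd : (c :: p.erase c).Nodup := hpe.nodup_iff.1 hp.nodup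
  have hmask : key V p - 2 ^ (c : ℕ) = mask (p.erase c) + (1 + cost V p) * 2 ^ m := by
    have : mask p = 2 ^ (c : ℕ) + mask (p.erase c) := by
      rw [mask, (hpe.map _).sum_eq]
      simp [mask]
    rw [key, this]
    omega
  rw [prevKey, hmask, addCost_mask V (List.nodup_cons.1 hnd).2] at hk
  set r := ((p.erase c).map (votes V c)).sum with hr
  have hpow : 0 < 2 ^ m := by positivity
  -- The `1 +` in `key` keeps every key positive, so the truncated subtraction in `hk`, whose result
  -- is a key, is a true one.
  have hqk : 2 ^ m ≤ key V q := by
    rw [key]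
    nlinarith [Nat.zero_le (cost V q * 2 ^ m)]
  have hk' : mask q + (1 + cost V q + r) * 2 ^ m
      = mask (p.erase c) + (1 + cost V p) * 2 ^ m := by
    have e : mask q + (1 + cost V q + r) * 2 ^ m = key V q + r * 2 ^ m := by
      rw [key]; ring
    omega
  have hmq := mask_lt hq.nodup
  have hme := mask_lt (List.nodup_cons.1 hnd).2
  have hm : mask q = mask (p.erase c) := by
    have h' := congrArg (· % 2 ^ m) hk'
    simpa [Nat.mod_eq_of_lt hmq, Nat.mod_eq_of_lt hme] using h'
  have hcost : 1 + cost V q + r = 1 + cost V p := by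
    rw [hm] at hk'
    exact Nat.eq_of_mul_eq_mul_right hpow (Nat.add_left_cancel hk')
  have hperm : q.Perm (p.erase c) := by
    rw [List.perm_ext_iff_of_nodup hq.nodup (List.nodup_cons.1 hnd).2]
    intro a
    have h1 := testBit_mask hq.nodup a
    rw [hm, testBit_mask (List.nodup_cons.1 hnd).2] at h1
    simpa using h1.symm
  have hperm' : p.Perm (c :: q) := hpe.trans (hperm.symm.cons c)
  have := h.congr hperm' (by
    rw [cost, (hperm.map _).sum_eq, ← hr]
    omega)
  simpa using this

/-- The prefixes `p` and `c :: q` may be ordered differently, but both complete `s` optimally and so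
have the same key. Thus no extension of a suffix is missed by storing one key with it. -/
theorem IsOptimal.prevKey_eq {V : Profile m n} {s p q : List (Fin m)} {c : Fin m}
    (h : IsOptimal V (s ++ p)) (h' : IsOptimal V (s ++ [c] ++ q)) :
    bit (key V p) c = 1 ∧ prevKey V (key V p) c = key V q := by
  have h'' : IsOptimal V (s ++ c :: q) := by simpa using h'
  have hnd : (c :: q).Nodup := h''.1.of_append_right
  obtain ⟨hperm, hcost⟩ := h.cost_eq h''
  have hk : key V p = key V (c :: q) := key_eq_of_perm hperm hcost
  rw [hk]
  constructor
  · rw [key, bit_mask hnd]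
    simp
  · have e : key V (c :: q) - 2 ^ (c : ℕ) = mask q + (1 + cost V (c :: q)) * 2 ^ m := by
      simp only [key, mask, List.map_cons, List.sum_cons]
      omega
    rw [prevKey, e, addCost_mask V (List.nodup_cons.1 hnd).2, key]
    simp only [cost]
    have : (1 + (cost V q + (q.map (votes V c)).sum)) * 2 ^ m
      = (1 + cost V q) * 2 ^ m + (q.map (votes V c)).sum * 2 ^ m := by ring
    omega

/-! ### Enumerating Kemeny rankings by their reversed suffixes -/

/-- Distinct suffixes of the same length of Kemeny rankings belong to distinct rankings. -/
theorem le_card_of_suffixes {V : Profile m n} {L lev : ℕ} (g : ℕ → List (Fin m))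
    (hg : Set.InjOn g (Set.Iio L)) (hlen : ∀ e < L, (g e).length = lev)
    (hopt : ∀ e < L, ∃ p, IsOptimal V (g e ++ p)) : L ≤ (kemenyRankings V).card := by
  have : ∀ e, ∃ Q, e < L → Q ∈ kemenyRankings V ∧ (revList Q).take lev = g e := by
    intro e
    by_cases he : e < L
    · obtain ⟨p, hp⟩ := hopt e he
      obtain ⟨Q, hQ, hQp⟩ := hp.exists_ranking
      refine ⟨Q, fun _ => ⟨hQ, ?_⟩⟩
      rw [hQp, ← hlen e he, List.take_left]
    · exact ⟨1, fun h => absurd h he⟩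
  choose Q hQ using this
  calc L = (Finset.range L).card := (Finset.card_range L).symm
    _ ≤ _ := Finset.card_le_card_of_injOn Q (fun e he => (hQ e (by simpa using he)).1) ?_
  intro e he e' he' h
  simp only [Finset.coe_range] at he he'
  apply hg he he'
  rw [← (hQ e he).2, ← (hQ e' he').2, h]

theorem card_le_of_complete {V : Profile m n} {L : ℕ} (g : ℕ → List (Fin m))
    (hcomp : ∀ s, IsOptimal V s → ∃ e < L, g e = s) : (kemenyRankings V).card ≤ L := by
  have : ∀ Q, ∃ e, Q ∈ kemenyRankings V → e < L ∧ g e = revList Q := by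
    intro Q
    by_cases hQ : Q ∈ kemenyRankings V
    · obtain ⟨e, he, h⟩ := hcomp _ ((isOptimal_revList_iff V Q).2 hQ)
      exact ⟨e, fun _ => ⟨he, h⟩⟩
    · exact ⟨0, fun h => absurd h hQ⟩
  choose e he using this
  rw [← Finset.card_range L]
  refine Finset.card_le_card_of_injOn e (fun Q hQ => ?_) fun Q hQ Q' hQ' h => ?_
  · simpa using (he Q hQ).1
  · have : revList Q = revList Q' := by rw [← (he Q hQ).2, ← (he Q' hQ').2, h]
    rw [revList, revList, List.reverse_inj, List.ofFn_inj] at this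
    exact Equiv.symm_bijective.injective (DFunLike.coe_injective this)

/-- A reversed list as a number in base `m`. -/
def codeNum (s : List (Fin m)) : ℕ := s.foldl (fun z c => z * m + c) 0

theorem codeNum_concat (s : List (Fin m)) (c : Fin m) :
    codeNum (s ++ [c]) = codeNum s * m + c := by
  simp [codeNum]

theorem codeNum_lt (s : List (Fin m)) : codeNum s < m ^ s.length := by
  induction s using List.reverseRecOn with
  | nil => simp [codeNum]
  | append_singleton s c ih =>
    rw [codeNum_concat, List.length_append, List.length_singleton, pow_succ]
    have := c.2
    nlinarith [Nat.mul_le_mul_right m (Nat.succ_le_of_lt ih)]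

/-- Suffixes grow towards the preferred end and a new candidate becomes the lowest digit, so in a
complete code digit `j` is the candidate at place `j`. Coding a suffix as one number lets it be
copied and extended by a single statement. -/
theorem codeNum_digit {s : List (Fin m)} (j : ℕ) (hj : j < s.length) :
    codeNum s / m ^ j % m = s.reverse[j]'(by simpa using hj) := by
  induction s using List.reverseRecOn generalizing j with
  | nil => simp at hj
  | append_singleton s c ih =>
    have hm : 0 < m := c.pos
    rw [codeNum_concat]
    cases j with
    | zero => simp [Nat.mod_eq_of_lt c.2]
    | succ j =>
      have hj' : j < s.length := by simpa using hj
      rw [pow_succ', ← Nat.div_div_eq_div_mul]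
      have : (codeNum s * m + c) / m = codeNum s := by
        rw [add_comm, Nat.add_mul_div_right _ _ hm, Nat.div_eq_of_lt c.2, zero_add]
      rw [this, ih j hj']
      simp

theorem codeNum_revList (Q : Ranking m) (j : Fin m) :
    codeNum (revList Q) / m ^ (j : ℕ) % m = Q.symm j := by
  rw [codeNum_digit (j : ℕ) (by simp [revList])]
  simp [revList]

end Counting

/-! ### Steps of the program logic -/

namespace Expr

instance : Add Expr := ⟨bin .add⟩
instance : Sub Expr := ⟨bin .sub⟩
instance : Mul Expr := ⟨bin .mul⟩
instance : Div Expr := ⟨bin .div⟩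
instance : Mod Expr := ⟨bin .mod⟩

@[simp] theorem eval_var (s : Store) (x : ℕ) : (var x).eval s = s.regs.getD x 0 := rfl
@[simp] theorem eval_lit (s : Store) (c : ℕ) : (lit c).eval s = c := rfl
@[simp] theorem eval_get (s : Store) (a : ℕ) (e : Expr) :
    (get a e).eval s = (s.arrs.getD a fun _ => 0) (e.eval s) := rfl
@[simp] theorem eval_add (s : Store) (e f : Expr) : (e + f).eval s = e.eval s + f.eval s := rfl
@[simp] theorem eval_sub (s : Store) (e f : Expr) : (e - f).eval s = e.eval s - f.eval s := rfl
@[simp] theorem eval_mul (s : Store) (e f : Expr) : (e * f).eval s = e.eval s * f.eval s := rfl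
@[simp] theorem eval_div (s : Store) (e f : Expr) : (e / f).eval s = e.eval s / f.eval s := rfl
@[simp] theorem eval_mod (s : Store) (e f : Expr) : (e % f).eval s = e.eval s % f.eval s := rfl

end Expr

attribute [simp] Store.setReg Store.setArr

@[simp] theorem getD_cons_zero' {α : Type*} (u : α) (l : List α) (d : α) :
    (u :: l).getD 0 d = u := rfl

@[simp] theorem getD_cons_succ' {α : Type*} (u : α) (l : List α) (i : ℕ) (d : α) :
    (u :: l).getD (i + 1) d = l.getD i d := rfl

namespace Runs

theorem seq_le {b k k₁ k₂ : ℕ} {p q : Prog} {s : Store} {Q : Store → Prop} (hk : k₁ + k₂ ≤ k)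
    (h : Runs b p s k₁ fun s' => Runs b q s' k₂ Q) : Runs b (.seq p q) s k Q :=
  (seq h).mono hk fun _ h => h

variable {b k x a : ℕ} {q : Prog} {s : Store} {Q : Store → Prop} {e f : Expr}

/-- For a store given by explicit lists, the condition in this form holds by evaluation. -/
theorem assign' (hx : decide (x < s.regs.length) = true) (he : e.Fits s)
    (hv : e.eval s < 2 ^ b) (hQ : Q (s.setReg x (e.eval s))) :
    Runs b (Kemeny.assign x e) s 1 Q :=
  assign (of_decide_eq_true hx) he hv hQ

theorem assign_then (hx : decide (x < s.regs.length) = true) (he : e.Fits s)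
    (hv : e.eval s < 2 ^ b) (hQ : Runs b q (s.setReg x (e.eval s)) k Q) :
    Runs b (.seq (Kemeny.assign x e) q) s (k + 1) Q :=
  (seq (assign' hx he hv hQ)).mono (by omega) fun _ h => h

theorem storeAt' (ha : decide (a < s.arrs.length) = true) (he : e.Fits s) (hf : f.Fits s)
    (hv : f.eval s < 2 ^ b) (hQ : Q (s.setArr a (e.eval s) (f.eval s))) :
    Runs b (Kemeny.storeAt a e f) s 1 Q :=
  storeAt (of_decide_eq_true ha) he hf hv hQ

theorem storeAt_then (ha : decide (a < s.arrs.length) = true) (he : e.Fits s) (hf : f.Fits s)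
    (hv : f.eval s < 2 ^ b) (hQ : Runs b q (s.setArr a (e.eval s) (f.eval s)) k Q) :
    Runs b (.seq (Kemeny.storeAt a e f) q) s (k + 1) Q :=
  (seq (storeAt' ha he hf hv hQ)).mono (by omega) fun _ h => h

end Runs

/-! ### The parts of the program

The registers hold: `0` the number of rankings found, `1` and `2` the numbers `m` and `n`, `3` the
number `r`, `4` the number `2 ^ m`, `5` and `6` loop counters, `7` and `8` the results of `scanProg`,
`9` a key, `10` a candidate, `11` the length of the queue, `12` a key, `13` the length of the
suffixes found, `14` the number of suffixes found that are longer by one. -/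

open Kemeny.Expr (var lit get)

local infixr:60 " ⨾ " => Prog.seq

/-- Tables of the powers of `2` and of `m`, in the arrays `6` and `9`. -/
def powProg : Prog :=
  storeAt 6 (lit 0) (lit 1) ⨾ storeAt 9 (lit 0) (lit 1) ⨾ assign 5 (lit 0) ⨾
  loopLt (var 5) (var 1)
    (storeAt 6 (var 5 + lit 1) (get 6 (var 5) * lit 2) ⨾
     storeAt 9 (var 5 + lit 1) (get 9 (var 5) * var 1) ⨾
     assign 5 (var 5 + lit 1)) ⨾
  assign 4 (get 6 (var 1))

/-- The positions of the candidates in the votes, in the array `3`. -/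
def posProg : Prog :=
  assign 5 (lit 0) ⨾
  loopLt (var 5) (var 2 * var 1)
    (storeAt 3 (var 5 / var 1 * var 1 + get 0 (lit 3 + var 5)) (var 5 % var 1) ⨾
     assign 5 (var 5 + lit 1))

/-- The numbers of votes that prefer a candidate to another, in the array `2`. -/
def votesProg : Prog :=
  assign 5 (lit 0) ⨾
  loopLt (var 5) (var 1 * var 1)
    (assign 7 (lit 0) ⨾ assign 6 (lit 0) ⨾
     loopLt (var 6) (var 2)
       (assign 7 (var 7 + (lit 1 - (get 3 (var 6 * var 1 + var 5 / var 1) + lit 1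
          - get 3 (var 6 * var 1 + var 5 % var 1)))) ⨾
        assign 6 (var 6 + lit 1)) ⨾
     storeAt 2 (var 5) (var 7) ⨾
     assign 5 (var 5 + lit 1))

/-- Cost and admissibility of appending the candidate in register `10` to a prefix whose key is in
register `9`. -/
def scanProg : Prog :=
  assign 7 (lit 0) ⨾ assign 8 (var 9 / get 6 (var 10) % lit 2) ⨾ assign 6 (lit 0) ⨾
  loopLt (var 6) (var 1)
    (assign 7 (var 7 + var 9 / get 6 (var 6) % lit 2 * get 2 (var 10 * var 1 + var 6)) ⨾
     assign 8 (var 8 + (lit 1 - var 9 / get 6 (var 6) % lit 2) *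
       (get 2 (var 6 * var 1 + var 10) / var 2)) ⨾
     assign 6 (var 6 + lit 1))

/-- Breadth-first search for all keys of paths; the array `4` is the queue, the array `5` marks the
keys in it. -/
def searchProg : Prog :=
  storeAt 4 (lit 0) (var 4) ⨾ storeAt 5 (var 4) (lit 1) ⨾ assign 11 (lit 1) ⨾ assign 5 (lit 0) ⨾
  loopLt (var 5) (var 11 * var 1)
    (assign 9 (get 4 (var 5 / var 1)) ⨾ assign 10 (var 5 % var 1) ⨾
     scanProg ⨾
     assign 12 (var 9 + get 6 (var 10) + var 7 * var 4) ⨾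
     -- The sum is zero exactly when the candidate is admissible and the new key is unmarked.
     whenLt (var 8 + get 5 (var 12)) (lit 1)
       (storeAt 5 (var 12) (lit 1) ⨾ storeAt 4 (var 11) (var 12) ⨾ assign 11 (var 11 + lit 1)) ⨾
     assign 5 (var 5 + lit 1))

/-- The smallest key of a complete path. -/
def goalProg : Prog :=
  assign 9 (var 4 - lit 1 + var 4) ⨾
  loopLt (get 5 (var 9)) (lit 1) (assign 9 (var 9 + var 4))

/-- The extensions by one candidate of the suffix with the number `q / m`. -/
def extendProg : Prog :=
  assign 10 (var 5 % var 1) ⨾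
  assign 9 (get 7 (var 5 / var 1 * (var 1 + lit 1) + var 13)) ⨾
  whenLt (lit 0) (var 9 / get 6 (var 10) % lit 2)
    (assign 9 (var 9 - get 6 (var 10)) ⨾ scanProg ⨾
     assign 9 (var 9 - var 7 * var 4) ⨾
     whenLt (lit 0) (get 5 (var 9)) (whenLt (var 14) (var 3)
       (storeAt 7 (var 14 * (var 1 + lit 1) + (var 13 + lit 1)) (var 9) ⨾
        storeAt 8 (var 14 * (var 1 + lit 1) + (var 13 + lit 1))
          (get 8 (var 5 / var 1 * (var 1 + lit 1) + var 13) * var 1 + var 10) ⨾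
        assign 14 (var 14 + lit 1)))) ⨾
  assign 5 (var 5 + lit 1)

/-- Suffixes of Kemeny rankings of all lengths: the key of the remaining prefix in the array `7`,
the code of the suffix in the array `8`. -/
def enumProg : Prog :=
  assign 0 (lit 0) ⨾ whenLt (lit 0) (var 3) (assign 0 (lit 1)) ⨾
  storeAt 7 (lit 0) (var 9) ⨾ storeAt 8 (lit 0) (lit 0) ⨾ assign 13 (lit 0) ⨾
  loopLt (var 13) (var 1)
    (assign 14 (lit 0) ⨾ assign 5 (lit 0) ⨾
     loopLt (var 5) (var 0 * var 1) extendProg ⨾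
     assign 0 (var 14) ⨾ assign 13 (var 13 + lit 1))

/-- Decoding of the rankings into the array `1`. -/
def outProg : Prog :=
  assign 5 (lit 0) ⨾
  loopLt (var 5) (var 0 * var 1)
    (storeAt 1 (var 5)
      (get 8 (var 5 / var 1 * (var 1 + lit 1) + var 1) / get 9 (var 5 % var 1) % var 1) ⨾
     assign 5 (var 5 + lit 1))

/-- Distinct OPT Kemeny Ranking Aggregation. -/
def kemenyProg : Prog :=
  assign 1 (get 0 (lit 0)) ⨾ assign 2 (get 0 (lit 1)) ⨾ assign 3 (get 0 (lit 2)) ⨾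
  powProg ⨾ posProg ⨾ votesProg ⨾ searchProg ⨾ goalProg ⨾ enumProg ⨾ outProg

/-! ### Correctness of the tables -/

section Tables

variable {b L m n r F q i acc bad x c tl y lev L' : ℕ} {A0 A1 A2 A3 A4 A5 A6 A7 A8 A9 : ℕ → ℕ}

theorem powProg_runs (hm : 0 < m) (hmb : m < 2 ^ b) (h2 : 2 ^ m < 2 ^ b) (hmm : m ^ m < 2 ^ b) :
    Runs b powProg ⟨[L, m, n, r, F, q, i, acc, bad, x, c, tl, y, lev, L'],
      [A0, A1, A2, A3, A4, A5, A6, A7, A8, A9]⟩ (5 * m + 6) fun s => ∃ q A6 A9,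
      s = ⟨[L, m, n, r, 2 ^ m, q, i, acc, bad, x, c, tl, y, lev, L'],
        [A0, A1, A2, A3, A4, A5, A6, A7, A8, A9]⟩ ∧
      (∀ i ≤ m, A6 i = 2 ^ i) ∧ ∀ i ≤ m, A9 i = m ^ i := by
  have h1b : 1 < 2 ^ b := lt_of_le_of_lt Nat.one_le_two_pow h2
  refine Runs.mono (k := m * (3 + 2) + 2 + 1 + 3) ?_ (by omega)
    fun _ h => h
  refine Runs.storeAt_then rfl ⟨rfl, by decide⟩ ⟨rfl, by decide⟩ h1b ?_
  refine Runs.storeAt_then rfl ⟨rfl, by decide⟩ ⟨rfl, by decide⟩ h1b ?_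
  refine Runs.assign_then rfl ⟨rfl, by decide⟩ (by positivity) ?_
  dsimp
  refine Runs.seq_le (k₁ := m * (3 + 2) + 2) (k₂ := 1) (by omega)
    (Runs.loopLt (fun q s => ∃ A6 A9,
      s = ⟨[L, m, n, r, F, q, i, acc, bad, x, c, tl, y, lev, L'],
        [A0, A1, A2, A3, A4, A5, A6, A7, A8, A9]⟩ ∧ q ≤ m ∧
      (∀ i ≤ q, A6 i = 2 ^ i) ∧ ∀ i ≤ q, A9 i = m ^ i) m ⟨_, _, rfl, ?_⟩ ?_ ?_ ?_)
  · simp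
  · rintro q s ⟨A6, A9, rfl, -⟩
    exact ⟨⟨rfl, by decide⟩, ⟨rfl, by decide⟩⟩
  · rintro q s - ⟨A6, A9, rfl, hq, h6, h9⟩ hlt
    dsimp at hlt
    have b6 : A6 q * 2 = 2 ^ (q + 1) := by rw [h6 q le_rfl, pow_succ]
    have b9 : A9 q * m = m ^ (q + 1) := by rw [h9 q le_rfl, pow_succ]
    refine ⟨hlt, ?_⟩
    refine Runs.storeAt_then rfl ⟨rfl, by decide⟩ ⟨rfl, by decide⟩ ?_ ?_
    · dsimp
      rw [b6]
      exact (Nat.pow_le_pow_right two_pos hlt).trans_lt h2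
    refine Runs.storeAt_then rfl ⟨rfl, by decide⟩ ⟨rfl, by decide⟩ ?_ ?_
    · dsimp
      rw [b9]
      exact (Nat.pow_le_pow_right hm hlt).trans_lt hmm
    refine Runs.assign' rfl ⟨rfl, by decide⟩ (by dsimp; omega) ⟨_, _, rfl, hlt, ?_, ?_⟩
    · intro j hj
      dsimp
      rcases eq_or_lt_of_le hj with rfl | hj
      · rw [Function.update_self, b6]
      · rw [Function.update_of_ne hj.ne, h6 j (by omega)]
    · intro j hj
      dsimp
      rcases eq_or_lt_of_le hj with rfl | hj
      · rw [Function.update_self, b9]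
      · rw [Function.update_of_ne hj.ne, h9 j (by omega)]
  · rintro q s ⟨A6, A9, rfl, hq, h6, h9⟩ hlt
    dsimp at hlt
    obtain rfl : q = m := by omega
    refine Runs.assign' rfl ⟨rfl, by decide⟩ (by dsimp; rwa [h6 q le_rfl]) ?_
    dsimp
    rw [h6 q le_rfl]
    exact ⟨_, _, _, rfl, h6, h9⟩

/-! ### Pairs as single indices -/

theorem flat_div {m i a : ℕ} (ha : a < m) : (i * m + a) / m = i := by
  rw [add_comm, Nat.add_mul_div_right _ _ (by omega), Nat.div_eq_of_lt ha, zero_add]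

theorem flat_mod {m i a : ℕ} (ha : a < m) : (i * m + a) % m = a := by
  rw [add_comm, Nat.add_mul_mod_self_right, Nat.mod_eq_of_lt ha]

theorem flat_inj {m i a i' a' : ℕ} (ha : a < m) (ha' : a' < m) (h : i * m + a = i' * m + a') :
    i = i' ∧ a = a' := by
  constructor
  · rw [← flat_div (i := i) ha, h, flat_div ha']
  · rw [← flat_mod (i := i) ha, h, flat_mod ha']

theorem flat_lt {m n i a : ℕ} (hi : i < n) (ha : a < m) : i * m + a < n * m := by
  nlinarith [Nat.mul_le_mul_right m (Nat.succ_le_of_lt hi)]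

/-- The input lists candidates by place, and the table is the inverse permutation. Cells are
processed in the order of places, so the invariant of the loop bounds `i * m + V i a` and not the
address `i * m + a`. -/
theorem posProg_runs (V : Profile m n) (hb : n * m < 2 ^ b)
    (hA0 : ∀ (i : Fin n) (j : Fin m), A0 (3 + (i * m + j)) = (V i).symm j) :
    Runs b posProg ⟨[L, m, n, r, F, q, i, acc, bad, x, c, tl, y, lev, L'],
      [A0, A1, A2, A3, A4, A5, A6, A7, A8, A9]⟩ (n * m * 4 + 3) fun s => ∃ q A3,
      s = ⟨[L, m, n, r, F, q, i, acc, bad, x, c, tl, y, lev, L'],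
        [A0, A1, A2, A3, A4, A5, A6, A7, A8, A9]⟩ ∧
      ∀ (i : Fin n) (a : Fin m), A3 (i * m + a) = V i a := by
  refine Runs.mono (k := n * m * (2 + 2) + 2 + 1) ?_ (by omega) fun _ h => h
  refine Runs.assign_then rfl ⟨rfl, by decide⟩ (by positivity) ?_
  dsimp
  refine Runs.loopLt (fun q s => ∃ A3,
      s = ⟨[L, m, n, r, F, q, i, acc, bad, x, c, tl, y, lev, L'],
        [A0, A1, A2, A3, A4, A5, A6, A7, A8, A9]⟩ ∧
      ∀ (i : Fin n) (a : Fin m), i * m + V i a < q → A3 (i * m + a) = V i a)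
      (n * m) ⟨_, rfl, by simp⟩ ?_ ?_ ?_
  · rintro q s ⟨A3, rfl, -⟩
    exact ⟨⟨rfl, by decide⟩, ⟨rfl, by decide⟩⟩
  · rintro q s - ⟨A3, rfl, h3⟩ hlt
    dsimp at hlt
    have hm : 0 < m := Nat.pos_of_ne_zero (by rintro rfl; simp at hlt)
    refine ⟨hlt, ?_⟩
    have hmod := Nat.mod_lt q hm
    let i0 : Fin n := ⟨q / m, Nat.div_lt_of_lt_mul (by rwa [mul_comm])⟩
    let j0 : Fin m := ⟨q % m, hmod⟩
    have hq : (i0 : ℕ) * m + j0 = q := Nat.div_add_mod' q m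
    refine Runs.storeAt_then rfl ⟨rfl, by decide⟩ ⟨rfl, by decide⟩ ?_ ?_
    · dsimp
      have := Nat.mod_le q m
      omega
    refine Runs.assign' rfl ⟨rfl, by decide⟩ (by dsimp; omega) ⟨_, rfl, ?_⟩
    intro i' a' hlt'
    dsimp
    have h0 : A0 (3 + q) = (V i0).symm j0 := by rw [← hA0, hq]
    rw [h0]
    by_cases he : i' = i0 ∧ a' = (V i0).symm j0
    · obtain ⟨rfl, rfl⟩ := he
      rw [Function.update_self, Equiv.apply_symm_apply]
    · rw [Function.update_of_ne]
      · refine h3 i' a' (lt_of_le_of_ne (Nat.lt_succ_iff.1 hlt') fun heq => he ?_)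
        obtain ⟨h1, h2⟩ := flat_inj (V i' a').2 j0.2 (heq.trans hq.symm)
        obtain rfl := Fin.ext h1
        exact ⟨rfl, by rw [← Fin.ext h2, Equiv.symm_apply_apply]⟩
      · intro heq
        obtain ⟨h1, h2⟩ := flat_inj a'.2 ((V i0).symm j0).2 heq
        exact he ⟨Fin.ext h1, Fin.ext h2⟩
  · rintro q s ⟨A3, rfl, h3⟩ hlt
    dsimp at hlt
    refine ⟨_, _, rfl, fun i a => h3 i a ?_⟩
    have := flat_lt i.2 (V i a).2
    omega

theorem votesProg_runs (V : Profile m n) (hb : m * m < 2 ^ b) (hnb : n < 2 ^ b)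
    (hA3 : ∀ (i : Fin n) (a : Fin m), A3 (i * m + a) = V i a) :
    Runs b votesProg ⟨[L, m, n, r, F, q, i, acc, bad, x, c, tl, y, lev, L'],
      [A0, A1, A2, A3, A4, A5, A6, A7, A8, A9]⟩ (m * m * (n * 4 + 8) + 3) fun s =>
      ∃ q i acc A2,
      s = ⟨[L, m, n, r, F, q, i, acc, bad, x, c, tl, y, lev, L'],
        [A0, A1, A2, A3, A4, A5, A6, A7, A8, A9]⟩ ∧
      ∀ a b : Fin m, A2 (a * m + b) = votes V a b := by
  refine Runs.mono (k := m * m * (n * (2 + 2) + 2 + 2 + 2 + 2) + 2 + 1) ?_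
    (by ring_nf; omega) fun _ h => h
  refine Runs.assign_then rfl ⟨rfl, by decide⟩ (by positivity) ?_
  dsimp
  refine Runs.loopLt (fun q s => ∃ i acc A2,
      s = ⟨[L, m, n, r, F, q, i, acc, bad, x, c, tl, y, lev, L'],
        [A0, A1, A2, A3, A4, A5, A6, A7, A8, A9]⟩ ∧
      ∀ a b : Fin m, a * m + b < q → A2 (a * m + b) = votes V a b)
      (m * m) ⟨_, _, _, rfl, by simp⟩ ?_ ?_ ?_
  · rintro q s ⟨i, acc, A2, rfl, -⟩
    exact ⟨⟨rfl, by decide⟩, ⟨rfl, by decide⟩⟩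
  · rintro q s - ⟨i, acc, A2, rfl, h2⟩ hlt
    dsimp at hlt
    have hm : 0 < m := Nat.pos_of_ne_zero (by rintro rfl; simp at hlt)
    let a : Fin m := ⟨q / m, Nat.div_lt_of_lt_mul hlt⟩
    let c' : Fin m := ⟨q % m, Nat.mod_lt q hm⟩
    have hq : (a : ℕ) * m + c' = q := Nat.div_add_mod' q m
    refine ⟨hlt, ?_⟩
    refine Runs.assign_then rfl ⟨rfl, by decide⟩ (by positivity) ?_
    refine Runs.assign_then rfl ⟨rfl, by decide⟩ (by positivity) ?_
    dsimp
    refine Runs.seq_le (k₁ := n * (2 + 2) + 2) (k₂ := 2) (by omega)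
      (Runs.loopLt (fun i s => ∃ acc,
      s = ⟨[L, m, n, r, F, q, i, acc, bad, x, c, tl, y, lev, L'],
        [A0, A1, A2, A3, A4, A5, A6, A7, A8, A9]⟩ ∧ i ≤ n ∧ acc ≤ i ∧
      acc = ∑ j ∈ Finset.range i, (1 - (A3 (j * m + q / m) + 1 - A3 (j * m + q % m))))
      n ⟨0, rfl, by simp⟩ ?_ ?_ ?_)
    · rintro i s ⟨acc, rfl, -⟩
      exact ⟨⟨rfl, by decide⟩, ⟨rfl, by decide⟩⟩
    · rintro i s - ⟨acc, rfl, -, hacc, hsum⟩ hlt'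
      dsimp at hlt'
      refine ⟨hlt', ?_⟩
      refine Runs.assign_then rfl ⟨rfl, by decide⟩ (by dsimp; omega) ?_
      refine Runs.assign' rfl ⟨rfl, by decide⟩ (by dsimp; omega) ⟨_, rfl, hlt', ?_, ?_⟩
      · dsimp
        omega
      · dsimp
        rw [Finset.sum_range_succ, hsum]
    · rintro i s ⟨acc, rfl, hi, hacc, hsum⟩ hlt'
      dsimp at hlt'
      obtain rfl : i = n := by omega
      -- Truncated subtraction serves as a comparison: `u + 1 - v` is zero exactly when `u < v`, and
      -- each summand is one exactly then.
      have hvotes : acc = votes V a c' := by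
        rw [hsum, Finset.sum_range, votes, Finset.card_filter]
        refine Finset.sum_congr rfl fun j _ => ?_
        rw [show q / m = (a : ℕ) from rfl, show q % m = (c' : ℕ) from rfl, hA3, hA3]
        split_ifs with h <;> rw [Fin.lt_def] at h <;> omega
      refine Runs.storeAt_then rfl ⟨rfl, by decide⟩ ⟨rfl, by decide⟩ (by dsimp; omega) ?_
      refine Runs.assign' rfl ⟨rfl, by decide⟩ (by dsimp; omega) ⟨_, _, _, rfl, ?_⟩
      intro a' b' hab
      dsimp
      by_cases he : (a' : ℕ) * m + b' = q
      · obtain ⟨h1, h2⟩ := flat_inj b'.2 c'.2 (he.trans hq.symm)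
        rw [he, Function.update_self, hvotes, Fin.ext h1, Fin.ext h2]
      · rw [Function.update_of_ne he]
        exact h2 a' b' (by omega)
  · rintro q s ⟨i, acc, A2, rfl, h2⟩ hlt
    dsimp at hlt
    refine ⟨_, _, _, _, rfl, fun a b => h2 a b ?_⟩
    have := flat_lt a.2 b.2
    omega

theorem scanProg_runs (V : Profile m n) (c : Fin m) (hb : m * n + m + 1 < 2 ^ b)
    (hA2 : ∀ a b : Fin m, A2 (a * m + b) = votes V a b) (hA6 : ∀ i ≤ m, A6 i = 2 ^ i) :
    Runs b scanProg ⟨[L, m, n, r, F, q, i, acc, bad, x, c, tl, y, lev, L'],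
      [A0, A1, A2, A3, A4, A5, A6, A7, A8, A9]⟩ (m * 5 + 5) fun s =>
      s = ⟨[L, m, n, r, F, q, m, addCost V x c, defect V x c, x, c, tl, y, lev, L'],
        [A0, A1, A2, A3, A4, A5, A6, A7, A8, A9]⟩ := by
  have hm : 0 < m := c.pos
  refine Runs.mono (k := m * (3 + 2) + 2 + 3) ?_ (by omega) fun _ h => h
  have hbit : ∀ i ≤ m, x / A6 i % 2 = bit x i := fun i hi => by rw [hA6 i hi, bit]
  have h1b : 1 < 2 ^ b := lt_of_le_of_lt (by omega) hb
  refine Runs.assign_then rfl ⟨rfl, by decide⟩ (by positivity) ?_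
  refine Runs.assign_then rfl ⟨rfl, by decide⟩ ?_ ?_
  · dsimp
    rw [hbit _ c.2.le]
    exact (bit_le_one _ _).trans_lt h1b
  refine Runs.assign_then rfl ⟨rfl, by decide⟩ (by positivity) ?_
  dsimp
  rw [hbit _ c.2.le]
  refine Runs.loopLt (fun i s => ∃ acc bad,
      s = ⟨[L, m, n, r, F, q, i, acc, bad, x, c, tl, y, lev, L'],
        [A0, A1, A2, A3, A4, A5, A6, A7, A8, A9]⟩ ∧ i ≤ m ∧ acc ≤ i * n ∧ bad ≤ i + 1 ∧
      acc = ∑ a ∈ Finset.range i, bit x a * A2 (c * m + a) ∧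
      bad = bit x c + ∑ a ∈ Finset.range i, (1 - bit x a) * (A2 (a * m + c) / n))
      m ⟨_, _, rfl, by simp [bit_le_one]⟩ ?_ ?_ ?_
  · rintro i s ⟨acc, bad, rfl, -⟩
    exact ⟨⟨rfl, by decide⟩, ⟨rfl, by decide⟩⟩
  · rintro i s - ⟨acc, bad, rfl, hi, hacc, hbad, hs1, hs2⟩ hlt
    dsimp at hlt
    have e1 : bit x i * A2 (c * m + i) ≤ n := by
      have h1 := hA2 c ⟨i, hlt⟩
      have h2 := votes_le V c ⟨i, hlt⟩
      dsimp at h1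
      rw [h1]
      have := bit_le_one x i
      nlinarith
    have e2 : (1 - bit x i) * (A2 (i * m + c) / n) ≤ 1 := by
      have h1 := hA2 ⟨i, hlt⟩ c
      have h2 := votes_le V ⟨i, hlt⟩ c
      dsimp at h1
      rw [h1]
      have h3 : votes V ⟨i, hlt⟩ c / n ≤ 1 := Nat.div_le_of_le_mul (by omega)
      calc _ ≤ 1 * 1 := Nat.mul_le_mul (by omega) h3
        _ = 1 := rfl
    have e3 : (i + 1) * n ≤ m * n := Nat.mul_le_mul_right n hlt
    rw [add_mul, one_mul] at e3
    refine ⟨hlt, ?_⟩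
    refine Runs.assign_then rfl ⟨rfl, by decide⟩ ?_ ?_
    · dsimp
      rw [hbit i hi]
      omega
    refine Runs.assign_then rfl ⟨rfl, by decide⟩ ?_ ?_
    · dsimp
      rw [hbit i hi]
      omega
    refine Runs.assign' rfl ⟨rfl, by decide⟩ (by dsimp; omega) ?_
    dsimp
    rw [hbit i hi]
    refine ⟨_, _, rfl, hlt, ?_, ?_, ?_, ?_⟩
    · rw [add_mul]; omega
    · omega
    · rw [Finset.sum_range_succ, hs1]
    · rw [Finset.sum_range_succ, hs2, add_assoc]
  · rintro i s ⟨acc, bad, rfl, hi, hacc, hbad, hs1, hs2⟩ hlt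
    dsimp at hlt
    obtain rfl : i = m := by omega
    rw [hs1, hs2, addCost, defect, Finset.sum_range, Finset.sum_range]
    simp only [hA2]

end Tables

/-! ### Correctness of the search -/

section Search

variable {m n : ℕ}

/-- The key after the candidate `c` is appended. -/
def nextKey (V : Profile m n) (x : ℕ) (c : Fin m) : ℕ :=
  x + 2 ^ (c : ℕ) + addCost V x c * 2 ^ m

/-- The queue `A4` of length `tl` and its marks `A5`, when the first `q` pairs of an entry and a
candidate have been processed. -/
structure SearchInv (V : Profile m n) (q tl : ℕ) (A4 A5 : ℕ → ℕ) : Prop where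
  pos : 0 < tl
  start : A4 0 = 2 ^ m
  inj : Set.InjOn A4 (Set.Iio tl)
  sound : ∀ e < tl, ∃ p, IsPath V p ∧ key V p = A4 e
  mark : ∀ x, 0 < A5 x ↔ ∃ e < tl, A4 e = x
  closed : ∀ e < tl, ∀ c : Fin m, e * m + c < q → defect V (A4 e) c = 0 →
    ∃ e' < tl, A4 e' = nextKey V (A4 e) c

namespace SearchInv

variable {V : Profile m n} {q tl : ℕ} {A4 A5 : ℕ → ℕ}

/-- The marks rely on an array of zeros; the queue may start with arbitrary contents, since only
entries below its length count. -/
theorem init (V : Profile m n) (A4 : ℕ → ℕ) :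
    SearchInv V 0 1 (Function.update A4 0 (2 ^ m)) (Function.update (fun _ => 0) (2 ^ m) 1) where
  pos := one_pos
  start := by simp
  inj := by
    intro e he e' he' _
    simp only [Set.mem_Iio] at he he'
    omega
  sound e he := by
    obtain rfl : e = 0 := by omega
    exact ⟨[], trivial, by simp [key_nil]⟩
  mark x := by
    by_cases hx : x = 2 ^ m
    · subst hx
      simp
    · simp [hx, Ne.symm hx]
  closed := by simp

/-- The entries are distinct keys of paths. This bound on the queue is also what makes the search
terminate in time. -/
theorem le_nodeBound (h : SearchInv V q tl A4 A5) (hn : 0 < n) : tl ≤ nodeBound V := by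
  have := card_le_nodeBound hn V ((Finset.range tl).image A4) (by
    intro x hx
    obtain ⟨e, he, rfl⟩ := Finset.mem_image.1 hx
    exact h.sound e (Finset.mem_range.1 he))
  rwa [Finset.card_image_of_injOn (by simpa using h.inj), Finset.card_range] at this

theorem lt_of_mem (h : SearchInv V q tl A4 A5) {e : ℕ} (he : e < tl) :
    A4 e < (m * m * n + 2) * 2 ^ m := by
  obtain ⟨p, hp, hk⟩ := h.sound e he
  exact hk ▸ key_lt V hp.nodup

theorem skip (h : SearchInv V q tl A4 A5) {e : ℕ} {c : Fin m} (hq : e * m + c = q)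
    (hc : defect V (A4 e) c = 0 → 0 < A5 (nextKey V (A4 e) c)) :
    SearchInv V (q + 1) tl A4 A5 := by
  refine { h with closed := fun e' he' c' hlt hd => ?_ }
  rcases eq_or_lt_of_le (Nat.lt_succ_iff.1 hlt) with heq | hlt
  · obtain ⟨rfl, hcc⟩ := flat_inj c'.2 c.2 (heq.trans hq.symm)
    obtain rfl := Fin.ext hcc
    exact (h.mark _).1 (hc hd)
  · exact h.closed e' he' c' hlt hd

theorem push (h : SearchInv V q tl A4 A5) (hn : 0 < n) {e : ℕ} (he : e < tl) {c : Fin m}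
    (hq : e * m + c = q) (hd : defect V (A4 e) c = 0) (hnew : A5 (nextKey V (A4 e) c) = 0) :
    SearchInv V (q + 1) (tl + 1) (Function.update A4 tl (nextKey V (A4 e) c))
      (Function.update A5 (nextKey V (A4 e) c) 1) := by
  have hold : ∀ e' < tl, Function.update A4 tl (nextKey V (A4 e) c) e' = A4 e' :=
    fun e' he' => Function.update_of_ne he'.ne _ _
  have hmark : ¬ ∃ e' < tl, A4 e' = nextKey V (A4 e) c := fun hex => by
    have := (h.mark _).2 hex
    omega
  constructor
  · omega
  · rw [hold 0 h.pos, h.start]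
  · intro e1 h1 e2 h2 heq
    simp only [Set.mem_Iio] at h1 h2
    rcases eq_or_lt_of_le (Nat.lt_succ_iff.1 h1) with rfl | h1 <;>
      rcases eq_or_lt_of_le (Nat.lt_succ_iff.1 h2) with rfl | h2
    · rfl
    · rw [Function.update_self, hold _ h2] at heq
      exact absurd ⟨e2, h2, heq.symm⟩ hmark
    · rw [Function.update_self, hold _ h1] at heq
      exact absurd ⟨e1, h1, heq⟩ hmark
    · rw [hold _ h1, hold _ h2] at heq
      exact h.inj h1 h2 heq
  · intro e1 h1
    rcases eq_or_lt_of_le (Nat.lt_succ_iff.1 h1) with rfl | h1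
    · obtain ⟨p, hp, hk⟩ := h.sound e he
      refine ⟨c :: p, (isPath_cons_iff hn hp c).2 (by rwa [hk]), ?_⟩
      rw [Function.update_self, key_cons V hp.nodup, hk, nextKey]
    · rw [hold _ h1]
      exact h.sound e1 h1
  · intro x
    by_cases hx : x = nextKey V (A4 e) c
    · subst hx
      simp only [Function.update_self, one_pos, true_iff]
      exact ⟨tl, by omega, by simp⟩
    · rw [Function.update_of_ne hx, h.mark]
      constructor
      · rintro ⟨e1, h1, rfl⟩
        exact ⟨e1, by omega, hold _ h1⟩
      · rintro ⟨e1, h1, heq⟩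
        rcases eq_or_lt_of_le (Nat.lt_succ_iff.1 h1) with rfl | h1
        · rw [Function.update_self] at heq
          exact absurd heq.symm hx
        · exact ⟨e1, h1, by rwa [hold _ h1] at heq⟩
  · intro e1 h1 c1 hlt hd1
    -- The new entry `tl` lies behind the current entry `e`, so none of its pairs has been processed
    -- yet.
    have h1' : e1 < tl := by
      have h2 : e1 * m < (e + 1) * m := by
        have := c.2
        rw [add_mul]
        omega
      have := Nat.lt_of_mul_lt_mul_right h2
      omega
    rw [hold _ h1'] at hd1 ⊢
    rcases eq_or_lt_of_le (Nat.lt_succ_iff.1 hlt) with heq | hlt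
    · obtain ⟨rfl, hcc⟩ := flat_inj c1.2 c.2 (heq.trans hq.symm)
      obtain rfl := Fin.ext hcc
      exact ⟨tl, by omega, by simp⟩
    · obtain ⟨e2, h2, heq⟩ := h.closed e1 h1' c1 hlt hd1
      exact ⟨e2, by omega, by rwa [hold _ h2]⟩

/-- Soundness is part of the invariant. Once all pairs are processed, the marked set contains the
empty prefix and is closed under admissible extension, hence contains every key of a path. -/
theorem mark_iff (h : SearchInv V q tl A4 A5) (hn : 0 < n) (hq : tl * m ≤ q) (x : ℕ) :
    0 < A5 x ↔ ∃ p, IsPath V p ∧ key V p = x := by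
  rw [h.mark]
  constructor
  · rintro ⟨e, he, rfl⟩
    exact h.sound e he
  · rintro ⟨p, hp, rfl⟩
    refine forall_isPath_of_closed hn V (fun x => ∃ e < tl, A4 e = x) ⟨0, h.pos, h.start⟩ ?_ hp
    rintro x ⟨e, he, rfl⟩ c hd
    exact h.closed e he c ((flat_lt he c.2).trans_le hq) hd

end SearchInv

theorem addCost_le (V : Profile m n) (x : ℕ) (c : Fin m) : addCost V x c ≤ m * n := by
  rw [addCost]
  refine (Finset.sum_le_card_nsmul _ _ n fun a _ => ?_).trans (by simp)
  calc bit x a * votes V c a ≤ 1 * n := Nat.mul_le_mul (bit_le_one _ _) (votes_le V c a)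
    _ = n := one_mul n

variable {b L r F q i acc bad x c tl y lev L' : ℕ} {A0 A1 A2 A3 A4 A5 A6 A7 A8 A9 : ℕ → ℕ}

theorem bounds_of_main (hm : 0 < m) (hn : 0 < n) (hb : (m * m * n + m * n + 4) * 2 ^ m < 2 ^ b) :
    m * n + m + 1 < 2 ^ b ∧ m * m < 2 ^ b ∧ n * m < 2 ^ b ∧ 2 ^ m < 2 ^ b := by
  have h1 : 1 ≤ 2 ^ m := Nat.one_le_two_pow
  have h2 : m * m * n + m * n + 4 ≤ (m * m * n + m * n + 4) * 2 ^ m := Nat.le_mul_of_pos_right _ h1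
  have h3 : m * m ≤ m * m * n := Nat.le_mul_of_pos_right _ hn
  have h4 : m ≤ m * m := Nat.le_mul_of_pos_right _ hm
  have h5 : 2 ^ m ≤ (m * m * n + m * n + 4) * 2 ^ m := Nat.le_mul_of_pos_left _ (by omega)
  rw [mul_comm n m]
  omega

theorem searchProg_runs (V : Profile m n) (hm : 0 < m) (hn : 0 < n)
    (hb : (m * m * n + m * n + 4) * 2 ^ m < 2 ^ b) (hnode : nodeBound V * m < 2 ^ b)
    (hA2 : ∀ a b : Fin m, A2 (a * m + b) = votes V a b) (hA6 : ∀ i ≤ m, A6 i = 2 ^ i) :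
    Runs b Kemeny.searchProg ⟨[L, m, n, r, 2 ^ m, q, i, acc, bad, x, c, tl, y, lev, L'],
      [A0, A1, A2, A3, A4, fun _ => 0, A6, A7, A8, A9]⟩ (nodeBound V * m * (5 * m + 15) + 6)
      fun s => ∃ q i acc bad x c tl y A4 A5,
      s = ⟨[L, m, n, r, 2 ^ m, q, i, acc, bad, x, c, tl, y, lev, L'],
        [A0, A1, A2, A3, A4, A5, A6, A7, A8, A9]⟩ ∧
      ∀ x, 0 < A5 x ↔ ∃ p, IsPath V p ∧ key V p = x := by
  obtain ⟨hbs, -, -, hb2⟩ := bounds_of_main hm hn hb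
  have h1b : 1 < 2 ^ b := lt_of_le_of_lt (by omega) hbs
  refine Runs.mono (k := nodeBound V * m * ((5 * m + 13) + 2) + 2 + 4) ?_ (le_of_eq (by ring)) fun _ h => h
  refine Runs.storeAt_then rfl ⟨rfl, by decide⟩ ⟨rfl, by decide⟩ hb2 ?_
  refine Runs.storeAt_then rfl ⟨rfl, by decide⟩ ⟨rfl, by decide⟩ h1b ?_
  refine Runs.assign_then rfl ⟨rfl, by decide⟩ h1b ?_
  refine Runs.assign_then rfl ⟨rfl, by decide⟩ (by positivity) ?_
  dsimp
  refine Runs.loopLt (fun q s => ∃ i acc bad x c tl y A4 A5,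
      s = ⟨[L, m, n, r, 2 ^ m, q, i, acc, bad, x, c, tl, y, lev, L'],
        [A0, A1, A2, A3, A4, A5, A6, A7, A8, A9]⟩ ∧ SearchInv V q tl A4 A5) (nodeBound V * m)
      ⟨_, _, _, _, _, _, _, _, _, rfl, .init V _⟩ ?_ ?_ ?_
  · rintro q s ⟨i, acc, bad, x, c, tl, y, A4, A5, rfl, -⟩
    exact ⟨⟨rfl, by decide⟩, ⟨rfl, by decide⟩⟩
  · rintro q s - ⟨i, acc, bad, x, c, tl, y, A4, A5, rfl, hinv⟩ hlt
    dsimp at hlt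
    have htl := hinv.le_nodeBound hn
    have htm : tl * m ≤ nodeBound V * m := Nat.mul_le_mul_right m htl
    have htb : nodeBound V ≤ nodeBound V * m := Nat.le_mul_of_pos_right _ hm
    refine ⟨hlt.trans_le htm, ?_⟩
    have he : q / m < tl := Nat.div_lt_of_lt_mul (by rwa [mul_comm])
    let c0 : Fin m := ⟨q % m, Nat.mod_lt q hm⟩
    have hq : q / m * m + c0 = q := Nat.div_add_mod' q m
    have hx := hinv.lt_of_mem he
    have hacc : addCost V (A4 (q / m)) c0 * 2 ^ m ≤ m * n * 2 ^ m :=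
      Nat.mul_le_mul_right _ (addCost_le V _ _)
    have hpow : 2 ^ (q % m) < 2 ^ m := Nat.pow_lt_pow_right (by norm_num) c0.2
    have hexp : (m * m * n + m * n + 4) * 2 ^ m
        = (m * m * n + 2) * 2 ^ m + m * n * 2 ^ m + 2 * 2 ^ m := by ring
    refine Runs.assign_then rfl ⟨rfl, by decide⟩ (by dsimp; omega) ?_
    refine Runs.assign_then rfl ⟨rfl, by decide⟩ ?_ ?_
    · dsimp
      have := Nat.mod_le q m
      omega
    dsimp
    refine Runs.seq_le (k₁ := m * 5 + 5) (k₂ := 6) (by omega)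
      ((scanProg_runs V c0 hbs hA2 hA6).mono le_rfl ?_)
    rintro s rfl
    refine Runs.assign_then rfl ⟨rfl, by decide⟩ ?_ ?_
    · dsimp
      rw [hA6 _ c0.2.le]
      dsimp [c0] at hacc ⊢
      omega
    dsimp
    rw [hA6 _ c0.2.le]
    change Runs b _ ⟨[L, m, n, r, 2 ^ m, q, m, addCost V (A4 (q / m)) c0, defect V (A4 (q / m)) c0,
      A4 (q / m), c0, tl, nextKey V (A4 (q / m)) c0, lev, L'],
      [A0, A1, A2, A3, A4, A5, A6, A7, A8, A9]⟩ 5 _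
    have hnk : nextKey V (A4 (q / m)) c0 < 2 ^ b := by
      rw [nextKey]
      dsimp [c0] at hacc ⊢
      omega
    refine Runs.seq_le (k₁ := 3 + 1) (k₂ := 1) (by omega)
      (Runs.whenLt ⟨rfl, by decide⟩ ⟨rfl, by decide⟩ (fun hlt => ?_) (fun hlt => ?_))
    · dsimp at hlt
      refine Runs.storeAt_then rfl ⟨rfl, by decide⟩ ⟨rfl, by decide⟩ h1b ?_
      refine Runs.storeAt_then rfl ⟨rfl, by decide⟩ ⟨rfl, by decide⟩ hnk ?_
      refine Runs.assign' rfl ⟨rfl, by decide⟩ ?_ ?_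
      · dsimp
        have := (hinv.push hn he hq (by omega) (by omega)).le_nodeBound hn
        omega
      refine Runs.assign' rfl ⟨rfl, by decide⟩ (by dsimp; omega) ?_
      exact ⟨_, _, _, _, _, _, _, _, _, rfl, hinv.push hn he hq (by omega) (by omega)⟩
    · dsimp at hlt
      refine Runs.assign' rfl ⟨rfl, by decide⟩ (by dsimp; omega) ?_
      exact ⟨_, _, _, _, _, _, _, _, _, rfl, hinv.skip hq (by omega)⟩
  · rintro q s ⟨i, acc, bad, x, c, tl, y, A4, A5, rfl, hinv⟩ hlt
    dsimp at hlt
    exact ⟨_, _, _, _, _, _, _, _, _, _, rfl, hinv.mark_iff hn (by omega)⟩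

theorem goalProg_runs (V : Profile m n) (hm : 0 < m) (hn : 0 < n)
    (hb : (m * m * n + m * n + 4) * 2 ^ m < 2 ^ b)
    (hA5 : ∀ x, 0 < A5 x ↔ ∃ p, IsPath V p ∧ key V p = x) :
    Runs b goalProg ⟨[L, m, n, r, 2 ^ m, q, i, acc, bad, x, c, tl, y, lev, L'],
      [A0, A1, A2, A3, A4, A5, A6, A7, A8, A9]⟩ ((m * m * n + 1) * 3 + 3)
      fun s => ∃ p, IsOptimal V p ∧
      s = ⟨[L, m, n, r, 2 ^ m, q, i, acc, bad, key V p, c, tl, y, lev, L'],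
        [A0, A1, A2, A3, A4, A5, A6, A7, A8, A9]⟩ := by
  obtain ⟨hbs, -, -, hb2⟩ := bounds_of_main hm hn hb
  have hpow : 1 ≤ 2 ^ m := Nat.one_le_two_pow
  have hexp : (m * m * n + m * n + 4) * 2 ^ m
        = (m * m * n + 1) * 2 ^ m + m * n * 2 ^ m + 3 * 2 ^ m := by ring
  refine Runs.mono (k := (m * m * n + 1) * (1 + 2) + 2 + 1) ?_ (by omega) fun _ h => h
  refine Runs.assign_then rfl ⟨rfl, by decide⟩ (by dsimp; omega) ?_
  dsimp
  refine Runs.loopLt (fun k s =>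
      s = ⟨[L, m, n, r, 2 ^ m, q, i, acc, bad, 2 ^ m - 1 + (1 + k) * 2 ^ m, c, tl, y, lev, L'],
        [A0, A1, A2, A3, A4, A5, A6, A7, A8, A9]⟩ ∧
      ∀ k' < k, ¬ ∃ p, IsPath V p ∧ key V p = 2 ^ m - 1 + (1 + k') * 2 ^ m) (m * m * n + 1)
      ⟨by simp, by simp⟩ ?_ ?_ ?_
  · rintro k s ⟨rfl, -⟩
    exact ⟨⟨rfl, by decide⟩, ⟨rfl, by decide⟩⟩
  · rintro k s - ⟨rfl, hk⟩ hlt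
    dsimp at hlt
    -- The scan cannot pass the key of an optimal list, whose cost is at most `m * m * n`.
    have hkn : k < m * m * n + 1 := by
      by_contra hge
      obtain ⟨p, hp⟩ := exists_isOptimal V
      have := cost_le_of_nodup V hp.1
      exact hk (cost V p) (by omega)
        ⟨p, isPath_of_isOptimal (s := []) hn hp, key_of_isOptimal hp⟩
    have hk2 : (1 + k) * 2 ^ m ≤ (m * m * n + 1) * 2 ^ m := Nat.mul_le_mul_right _ (by omega)
    refine ⟨hkn, Runs.assign' rfl ⟨rfl, by decide⟩ (by dsimp; omega) ⟨?_, ?_⟩⟩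
    · dsimp
      rw [show 2 ^ m - 1 + (1 + k) * 2 ^ m + 2 ^ m = 2 ^ m - 1 + (1 + (k + 1)) * 2 ^ m by ring]
    · intro k' hk'
      rcases eq_or_lt_of_le (Nat.lt_succ_iff.1 hk') with rfl | hk'
      · rw [← hA5]
        omega
      · exact hk k' hk'
  · rintro k s ⟨rfl, hk⟩ hlt
    dsimp at hlt
    obtain ⟨p, hp, hpk⟩ := (hA5 _).1 (show 0 < A5 (2 ^ m - 1 + (1 + k) * 2 ^ m) by omega)
    exact ⟨p, isOptimal_of_first hn hp hpk hk, by rw [hpk]⟩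

end Search

/-! ### Correctness of the enumeration -/

section Enumeration

variable {m n : ℕ}

/-- The first `L` entries of the column `lev` hold the suffixes `g e`, of length `lev`, of Kemeny
rankings and the keys of the remaining prefixes `h e`. -/
def Column (V : Profile m n) (lev L : ℕ) (A7 A8 : ℕ → ℕ) (g h : ℕ → List (Fin m)) : Prop :=
  ∀ e < L, (g e).length = lev ∧ IsOptimal V (g e ++ h e) ∧
    A7 (e * (m + 1) + lev) = key V (h e) ∧ A8 (e * (m + 1) + lev) = codeNum (g e)

/-- The column `lev` holds `L` distinct suffixes, and all of them if there are fewer than `r`. -/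
structure LevelInv (V : Profile m n) (r lev L : ℕ) (A7 A8 : ℕ → ℕ) (g h : ℕ → List (Fin m)) :
    Prop where
  le : L ≤ r
  inj : Set.InjOn g (Set.Iio L)
  col : Column V lev L A7 A8 g h
  complete : L < r → ∀ s p, s.length = lev → IsOptimal V (s ++ p) → ∃ e < L, g e = s

/-- The column `lev + 1` holds extensions of suffixes in the column `lev`, when the first `q` pairs
of a suffix and a candidate have been processed. -/
structure ExtendInv (V : Profile m n) (r lev L : ℕ) (g h : ℕ → List (Fin m)) (q L' : ℕ)
    (A7 A8 : ℕ → ℕ) (g' h' : ℕ → List (Fin m)) : Prop where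
  le : L' ≤ r
  inj : Set.InjOn g' (Set.Iio L')
  old : Column V lev L A7 A8 g h
  col : Column V (lev + 1) L' A7 A8 g' h'
  origin : ∀ e' < L', ∃ e < L, ∃ c : Fin m, e * m + c < q ∧ g' e' = g e ++ [c]
  complete : L' < r → ∀ e < L, ∀ (c : Fin m) (p : List (Fin m)), e * m + c < q →
    IsOptimal V (g e ++ [c] ++ p) → ∃ e' < L', g' e' = g e ++ [c]

variable {V : Profile m n} {r lev L L' q e c : ℕ} {A7 A8 : ℕ → ℕ} {g h g' h' : ℕ → List (Fin m)}

theorem Column.update (hc : Column V lev L A7 A8 g h) {lev' : ℕ} (h1 : lev < m + 1)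
    (h2 : lev' < m + 1) (hne : lev ≠ lev') (e0 u v : ℕ) :
    Column V lev L (Function.update A7 (e0 * (m + 1) + lev') u)
      (Function.update A8 (e0 * (m + 1) + lev') v) g h := by
  intro e he
  have : e * (m + 1) + lev ≠ e0 * (m + 1) + lev' := fun heq => hne (flat_inj h1 h2 heq).2
  rw [Function.update_of_ne this, Function.update_of_ne this]
  exact hc e he

theorem Column.push (hc : Column V lev L A7 A8 g h) (h1 : lev < m + 1) {s p : List (Fin m)}
    (hs : s.length = lev) (hopt : IsOptimal V (s ++ p)) :
    Column V lev (L + 1) (Function.update A7 (L * (m + 1) + lev) (key V p))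
      (Function.update A8 (L * (m + 1) + lev) (codeNum s)) (Function.update g L s)
      (Function.update h L p) := by
  intro e he
  rcases eq_or_lt_of_le (Nat.lt_succ_iff.1 he) with rfl | he
  · simp [hs, hopt]
  · have : e * (m + 1) + lev ≠ L * (m + 1) + lev := fun heq => he.ne (flat_inj h1 h1 heq).1
    rw [Function.update_of_ne this, Function.update_of_ne this, Function.update_of_ne he.ne,
      Function.update_of_ne he.ne]
    exact hc e he

theorem LevelInv.init (A7 A8 : ℕ → ℕ) {p : List (Fin m)} (hp : IsOptimal V p) (r : ℕ) :
    LevelInv V r 0 (min r 1) (Function.update A7 0 (key V p)) (Function.update A8 0 0)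
      (fun _ => []) fun _ => p where
  le := min_le_left _ _
  inj := by
    intro e he e' he' _
    simp only [Set.mem_Iio] at he he'
    omega
  col := by
    intro e he
    obtain rfl : e = 0 := by omega
    simp [hp, codeNum]
  complete hr s q hs _ := ⟨0, by omega, (List.eq_nil_of_length_eq_zero hs).symm⟩

/-- Every stored suffix completes to a Kemeny ranking, and distinct ones to distinct rankings, so no
intermediate level outgrows the output. -/
theorem LevelInv.le_numSolutions (hl : LevelInv V r lev L A7 A8 g h) : L ≤ numSolutions V r :=
  le_min hl.le (le_card_of_suffixes g hl.inj (fun e he => (hl.col e he).1)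
    fun e he => ⟨h e, (hl.col e he).2.1⟩)

theorem LevelInv.eq_numSolutions (hl : LevelInv V r m L A7 A8 g h) : L = numSolutions V r := by
  refine le_antisymm hl.le_numSolutions ?_
  by_cases hr : L < r
  · refine (min_le_right _ _).trans (card_le_of_complete g fun s hs => ?_)
    refine hl.complete hr s [] ?_ (by simpa using hs)
    obtain ⟨Q, -, rfl⟩ := hs.exists_ranking
    simp [revList]
  · exact (min_le_left _ _).trans (by omega)

theorem LevelInv.extendInv (hl : LevelInv V r lev L A7 A8 g h) :
    ExtendInv V r lev L g h 0 0 A7 A8 g h where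
  le := Nat.zero_le _
  inj := by intro e he; simp at he
  old := hl.col
  col := by intro e he; simp at he
  origin := by simp
  complete := by simp

namespace ExtendInv

theorem skip (hx : ExtendInv V r lev L g h q L' A7 A8 g' h') {e : ℕ} {c : Fin m}
    (hq : e * m + c = q) (hs : L' < r → ¬ ∃ p, IsOptimal V (g e ++ [c] ++ p)) :
    ExtendInv V r lev L g h (q + 1) L' A7 A8 g' h' := by
  refine { hx with origin := fun e' he' => ?_, complete := fun hr e1 h1 c1 p hlt hp => ?_ }
  · obtain ⟨e1, h1, c1, hlt, heq⟩ := hx.origin e' he'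
    exact ⟨e1, h1, c1, by omega, heq⟩
  · rcases eq_or_lt_of_le (Nat.lt_succ_iff.1 hlt) with heq | hlt
    · obtain ⟨rfl, hcc⟩ := flat_inj c1.2 c.2 (heq.trans hq.symm)
      obtain rfl := Fin.ext hcc
      exact absurd ⟨p, hp⟩ (hs hr)
    · exact hx.complete hr e1 h1 c1 p hlt hp

theorem push (hx : ExtendInv V r lev L g h q L' A7 A8 g' h') (hg : Set.InjOn g (Set.Iio L))
    (hlev : lev < m) {e : ℕ} {c : Fin m} (he : e < L) (hq : e * m + c = q) (hr : L' < r)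
    {p : List (Fin m)} (hp : IsOptimal V (g e ++ [c] ++ p)) :
    ExtendInv V r lev L g h (q + 1) (L' + 1)
      (Function.update A7 (L' * (m + 1) + (lev + 1)) (key V p))
      (Function.update A8 (L' * (m + 1) + (lev + 1)) (codeNum (g e ++ [c])))
      (Function.update g' L' (g e ++ [c])) (Function.update h' L' p) := by
  have hold : ∀ e' < L', Function.update g' L' (g e ++ [c]) e' = g' e' :=
    fun e' he' => Function.update_of_ne he'.ne _ _
  -- An equal suffix found earlier would stem from the same pair `(e, c)`, by injectivity of `g`;
  -- but that pair has the number `q` and is only now being processed.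
  have hnew : ∀ e' < L', g' e' ≠ g e ++ [c] := by
    intro e' he' heq
    obtain ⟨e1, h1, c1, hlt, heq1⟩ := hx.origin e' he'
    rw [heq1] at heq
    obtain ⟨hge, hce⟩ := List.append_inj' heq rfl
    obtain rfl := hg h1 he hge
    simp only [List.cons.injEq, and_true] at hce
    subst hce
    omega
  constructor
  · exact hr
  · intro e1 h1 e2 h2 heq
    simp only [Set.mem_Iio] at h1 h2
    rcases eq_or_lt_of_le (Nat.lt_succ_iff.1 h1) with rfl | h1 <;>
      rcases eq_or_lt_of_le (Nat.lt_succ_iff.1 h2) with rfl | h2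
    · rfl
    · rw [Function.update_self, hold _ h2] at heq
      exact absurd heq.symm (hnew _ h2)
    · rw [Function.update_self, hold _ h1] at heq
      exact absurd heq (hnew _ h1)
    · rw [hold _ h1, hold _ h2] at heq
      exact hx.inj h1 h2 heq
  · exact hx.old.update (by omega) (by omega) (by omega) _ _ _
  · refine hx.col.push (by omega) ?_ hp
    simp [(hx.old e he).1]
  · intro e' he'
    rcases eq_or_lt_of_le (Nat.lt_succ_iff.1 he') with rfl | he'
    · exact ⟨e, he, c, by omega, by simp⟩
    · obtain ⟨e1, h1, c1, hlt, heq⟩ := hx.origin e' he'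
      exact ⟨e1, h1, c1, by omega, by rwa [hold _ he']⟩
  · intro hr' e1 h1 c1 p1 hlt hp1
    rcases eq_or_lt_of_le (Nat.lt_succ_iff.1 hlt) with heq | hlt
    · obtain ⟨rfl, hcc⟩ := flat_inj c1.2 c.2 (heq.trans hq.symm)
      obtain rfl := Fin.ext hcc
      exact ⟨L', by omega, by simp⟩
    · obtain ⟨e2, h2, heq⟩ := hx.complete hr e1 h1 c1 p1 hlt hp1
      exact ⟨e2, by omega, by rwa [hold _ h2]⟩

/-- Every suffix in the column `lev` has an extension. -/
theorem le_of_lt (hx : ExtendInv V r lev L g h q L' A7 A8 g' h') (hg : Set.InjOn g (Set.Iio L))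
    (hlev : lev < m) (hq : L * m ≤ q) (hr : L' < r) : L ≤ L' := by
  have : ∀ e, ∃ e', e < L → e' < L' ∧ ∃ c, g' e' = g e ++ [c] := by
    intro e
    by_cases he : e < L
    · obtain ⟨hlen, hopt, -⟩ := hx.old e he
      obtain ⟨Q, -, hQ⟩ := hopt.exists_ranking
      have hl := congrArg List.length hQ
      rw [List.length_append, hlen] at hl
      simp only [revList, List.length_reverse, List.length_ofFn] at hl
      cases hh : h e with
      | nil => simp [hh] at hl; omega
      | cons c p =>
        obtain ⟨e', he', heq⟩ := hx.complete hr e he c p ((flat_lt he c.2).trans_le hq)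
          (by simpa [hh] using hopt)
        exact ⟨e', fun _ => ⟨he', c, heq⟩⟩
    · exact ⟨0, fun h => absurd h he⟩
  choose f hf using this
  calc L = (Finset.range L).card := (Finset.card_range L).symm
    _ ≤ (Finset.range L').card := Finset.card_le_card_of_injOn f
        (fun e he => by simpa using (hf e (by simpa using he)).1) ?_
    _ = L' := Finset.card_range L'
  intro e he e' he' heq
  simp only [Finset.coe_range] at he he'
  obtain ⟨-, c, h1⟩ := hf e he
  obtain ⟨-, c', h2⟩ := hf e' he'
  rw [heq, h2] at h1
  exact hg he he' (List.append_inj' h1 rfl).1.symm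

/-- Room left in the new level means room left in the old one, as `le_of_lt` gives `L ≤ L'`. The old
level was then complete, and every longer suffix arises from its first `lev` candidates. -/
theorem levelInv (hx : ExtendInv V r lev L g h q L' A7 A8 g' h')
    (hl : L < r → ∀ s p, s.length = lev → IsOptimal V (s ++ p) → ∃ e < L, g e = s)
    (hg : Set.InjOn g (Set.Iio L)) (hlev : lev < m) (hq : L * m ≤ q) :
    LevelInv V r (lev + 1) L' A7 A8 g' h' := by
  refine ⟨hx.le, hx.inj, hx.col, fun hr s p hs hopt => ?_⟩
  have hLL := hx.le_of_lt hg hlev hq hr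
  induction s using List.reverseRecOn with
  | nil => simp at hs
  | append_singleton s c _ =>
    obtain ⟨e, he, rfl⟩ := hl (by omega) s (c :: p) (by simpa using hs) (by simpa using hopt)
    exact hx.complete hr e he c p ((flat_lt he c.2).trans_le hq) hopt

end ExtendInv

variable {b F i acc bad x tl y : ℕ} {A0 A1 A2 A3 A4 A5 A6 A9 : ℕ → ℕ}

theorem extendProg_runs (hm : 0 < m) (hn : 0 < n)
    (hb : (m * m * n + m * n + 4) * 2 ^ m < 2 ^ b) (hmm : m ^ m < 2 ^ b) (hrb : r < 2 ^ b)
    (hLb : L * m < 2 ^ b)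
    (hA2 : ∀ a b : Fin m, A2 (a * m + b) = votes V a b) (hA6 : ∀ i ≤ m, A6 i = 2 ^ i)
    (hA5 : ∀ x, 0 < A5 x ↔ ∃ p, IsPath V p ∧ key V p = x)
    (hg : Set.InjOn g (Set.Iio L)) (hlev : lev < m) (hq : q < L * m)
    (hx : ExtendInv V r lev L g h q L' A7 A8 g' h') :
    Runs b extendProg ⟨[L, m, n, r, 2 ^ m, q, i, acc, bad, x, c, tl, y, lev, L'],
      [A0, A1, A2, A3, A4, A5, A6, A7, A8, A9]⟩ (5 * m + 16)
      fun s => ∃ i acc bad x c L' A7 A8 g' h',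
      s = ⟨[L, m, n, r, 2 ^ m, q + 1, i, acc, bad, x, c, tl, y, lev, L'],
        [A0, A1, A2, A3, A4, A5, A6, A7, A8, A9]⟩ ∧
      ExtendInv V r lev L g h (q + 1) L' A7 A8 g' h' := by
  obtain ⟨hbs, -, -, hb2⟩ := bounds_of_main hm hn hb
  have he : q / m < L := Nat.div_lt_of_lt_mul (by rwa [mul_comm])
  obtain ⟨c0, hc0⟩ : ∃ c0 : Fin m, (c0 : ℕ) = q % m := ⟨⟨q % m, Nat.mod_lt q hm⟩, rfl⟩
  generalize he0 : q / m = e0 at he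
  have hqe : e0 * m + c0 = q := by rw [hc0, ← he0]; exact Nat.div_add_mod' q m
  obtain ⟨hlen, hopt, h7, h8⟩ := hx.old e0 he
  have hpath : IsPath V (h e0) := isPath_of_isOptimal hn hopt
  have hkey : key V (h e0) < 2 ^ b := by
    refine (key_lt V hpath.nodup).trans_le (le_trans ?_ hb.le)
    exact Nat.mul_le_mul_right _ (by omega)
  refine Runs.assign_then (k := 5 * m + 15) rfl ⟨rfl, by decide⟩ ?_ ?_
  · dsimp
    have := Nat.mod_le q m
    omega
  refine Runs.assign_then (k := 5 * m + 14) rfl ⟨rfl, by decide⟩ (by dsimp; rwa [he0, h7]) ?_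
  dsimp
  rw [he0, h7, ← hc0]
  refine Runs.seq_le (k₁ := 5 * m + 12 + 1) (k₂ := 1) (by omega)
    (Runs.whenLt ⟨rfl, by decide⟩ ⟨rfl, by decide⟩ (fun hlt => ?_) (fun hlt => ?_))
  swap
  · dsimp at hlt
    rw [hA6 _ c0.2.le] at hlt
    refine Runs.assign' rfl ⟨rfl, by decide⟩ (by dsimp; omega) ?_
    refine ⟨_, _, _, _, _, _, _, _, _, _, rfl, hx.skip hqe ?_⟩
    rintro - ⟨p, hp⟩
    have := (hopt.prevKey_eq hp).1
    rw [bit] at this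
    omega
  dsimp at hlt
  rw [hA6 _ c0.2.le] at hlt
  have hbit : bit (key V (h e0)) c0 = 1 := by
    have := bit_le_one (key V (h e0)) c0
    rw [bit] at this ⊢
    omega
  refine Runs.assign_then (k := 5 * m + 11) rfl ⟨rfl, by decide⟩ (by dsimp; omega) ?_
  dsimp
  rw [hA6 _ c0.2.le]
  refine Runs.seq_le (k₁ := m * 5 + 5) (k₂ := 6) (by omega)
      ((scanProg_runs V c0 hbs hA2 hA6).mono le_rfl ?_)
  rintro s rfl
  -- Subtraction only lowers the value, so the bound holds before it is known whether this number is
  -- the key of a path.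
  have hprev : prevKey V (key V (h e0)) c0 < 2 ^ b :=
    (Nat.sub_le _ _).trans_lt ((Nat.sub_le _ _).trans_lt hkey)
  refine Runs.assign_then rfl ⟨rfl, by decide⟩ hprev ?_
  dsimp
  change Runs b _ ⟨[L, m, n, r, 2 ^ m, q, m, addCost V (key V (h e0) - 2 ^ (c0 : ℕ)) c0,
    defect V (key V (h e0) - 2 ^ (c0 : ℕ)) c0, prevKey V (key V (h e0)) c0, c0, tl, y, lev, L'],
      [A0, A1, A2, A3, A4, A5, A6, A7, A8, A9]⟩ 5 _
  refine Runs.whenLt ⟨rfl, by decide⟩ ⟨rfl, by decide⟩ (fun hlt => ?_) (fun hlt => ?_)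
  swap
  · dsimp at hlt
    refine Runs.assign' rfl ⟨rfl, by decide⟩ (by dsimp; omega) ?_
    refine ⟨_, _, _, _, _, _, _, _, _, _, rfl, hx.skip hqe ?_⟩
    rintro - ⟨p, hp⟩
    rw [hA5] at hlt
    exact hlt ⟨p, isPath_of_isOptimal hn hp, (hopt.prevKey_eq hp).2.symm⟩
  dsimp at hlt
  rw [hA5] at hlt
  obtain ⟨p, hp, hpk⟩ := hlt
  have hext := hopt.extend hpath hbit hp hpk
  refine Runs.whenLt ⟨rfl, by decide⟩ ⟨rfl, by decide⟩ (fun hlt => ?_) (fun hlt => ?_)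
  swap
  · dsimp at hlt
    refine Runs.assign' rfl ⟨rfl, by decide⟩ (by dsimp; omega) ?_
    exact ⟨_, _, _, _, _, _, _, _, _, _, rfl, hx.skip hqe fun h => absurd h hlt⟩
  dsimp at hlt
  have hpush := hx.push hg hlev he hqe hlt hext
  have hcode : codeNum (g e0) * m + c0 < 2 ^ b := by
    rw [← codeNum_concat]
    refine (codeNum_lt _).trans_le (le_trans ?_ hmm.le)
    exact Nat.pow_le_pow_right hm (by simp [hlen, Nat.succ_le_of_lt hlev])
  refine Runs.storeAt_then rfl ⟨rfl, by decide⟩ ⟨rfl, by decide⟩ hprev ?_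
  refine Runs.storeAt_then rfl ⟨rfl, by decide⟩ ⟨rfl, by decide⟩ (by dsimp; rwa [he0, h8]) ?_
  refine Runs.assign' rfl ⟨rfl, by decide⟩ (by dsimp; omega) ?_
  refine Runs.assign' rfl ⟨rfl, by decide⟩ (by dsimp; omega) ?_
  dsimp
  rw [he0, h8, ← hpk, ← codeNum_concat]
  exact ⟨_, _, _, _, _, _, _, _, _, _, rfl, hpush⟩

theorem enumProg_runs (hm : 0 < m) (hn : 0 < n)
    (hb : (m * m * n + m * n + 4) * 2 ^ m < 2 ^ b) (hmm : m ^ m < 2 ^ b) (hrb : r < 2 ^ b)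
    (hLb : numSolutions V r * m < 2 ^ b)
    (hA2 : ∀ a b : Fin m, A2 (a * m + b) = votes V a b) (hA6 : ∀ i ≤ m, A6 i = 2 ^ i)
    (hA5 : ∀ x, 0 < A5 x ↔ ∃ p, IsPath V p ∧ key V p = x) {p : List (Fin m)}
    (hp : IsOptimal V p) :
    Runs b enumProg ⟨[L, m, n, r, 2 ^ m, q, i, acc, bad, key V p, c, tl, y, lev, L'],
      [A0, A1, A2, A3, A4, A5, A6, A7, A8, A9]⟩
      (m * (numSolutions V r * m * (5 * m + 18) + 8) + 8)
      fun s => ∃ q i acc bad x c lev L' A7 A8 g h,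
      s = ⟨[numSolutions V r, m, n, r, 2 ^ m, q, i, acc, bad, x, c, tl, y, lev, L'],
        [A0, A1, A2, A3, A4, A5, A6, A7, A8, A9]⟩ ∧
      LevelInv V r m (numSolutions V r) A7 A8 g h := by
  obtain ⟨hbs, -, -, hb2⟩ := bounds_of_main hm hn hb
  have h1b : 1 < 2 ^ b := lt_of_le_of_lt (by omega) hbs
  have hkey : key V p < 2 ^ b := by
    refine (key_lt V hp.1).trans_le (le_trans ?_ hb.le)
    exact Nat.mul_le_mul_right _ (by omega)
  refine Runs.mono (k := m * ((numSolutions V r * m * ((5 * m + 16) + 2) + 2 + 4) + 2) + 2 + 3 + 2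
    + 1) ?_ (le_of_eq (by ring)) fun _ h => h
  refine Runs.assign_then rfl ⟨rfl, by decide⟩ (by positivity) ?_
  dsimp
  refine Runs.seq_le (k₁ := 1 + 1)
    (k₂ := m * ((numSolutions V r * m * ((5 * m + 16) + 2) + 2 + 4) + 2) + 2 + 3) (by omega)
    (Runs.mono (k := 1 + 1) (Q := fun s => s = ⟨[min r 1, m, n, r, 2 ^ m, q, i, acc, bad, key V p,
      c, tl, y, lev, L'], [A0, A1, A2, A3, A4, A5, A6, A7, A8, A9]⟩)
      (Runs.whenLt ⟨rfl, by decide⟩ ⟨rfl, by decide⟩ (fun hlt => ?_) (fun hlt => ?_)) le_rfl ?_)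
  · dsimp at hlt
    refine Runs.assign' rfl ⟨rfl, by decide⟩ h1b ?_
    dsimp
    rw [min_eq_right hlt]
  · dsimp at hlt
    rw [min_eq_left (by omega), Nat.eq_zero_of_not_pos hlt]
  rintro s rfl
  refine Runs.storeAt_then rfl ⟨rfl, by decide⟩ ⟨rfl, by decide⟩ hkey ?_
  refine Runs.storeAt_then rfl ⟨rfl, by decide⟩ ⟨rfl, by decide⟩ (by positivity) ?_
  refine Runs.assign_then rfl ⟨rfl, by decide⟩ (by positivity) ?_
  dsimp
  refine Runs.loopLt (fun lev s => ∃ L q i acc bad x c L' A7 A8 g h,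
      s = ⟨[L, m, n, r, 2 ^ m, q, i, acc, bad, x, c, tl, y, lev, L'],
        [A0, A1, A2, A3, A4, A5, A6, A7, A8, A9]⟩ ∧ lev ≤ m ∧
      LevelInv V r lev L A7 A8 g h) m
      ⟨_, _, _, _, _, _, _, _, _, _, _, _, rfl, Nat.zero_le _, .init A7 A8 hp r⟩ ?_ ?_ ?_
  · rintro lev s ⟨L, q, i, acc, bad, x, c, L', A7, A8, g, h, rfl, -⟩
    exact ⟨⟨rfl, by decide⟩, ⟨rfl, by decide⟩⟩
  · rintro lev s - ⟨L, q, i, acc, bad, x, c, L', A7, A8, g, h, rfl, -, hl⟩ hlev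
    dsimp at hlev
    -- The point where the time becomes polynomial in the output: the inner loop makes `L * m`
    -- rounds.
    have hLn := Nat.mul_le_mul_right m hl.le_numSolutions
    refine ⟨hlev, ?_⟩
    refine Runs.assign_then rfl ⟨rfl, by decide⟩ (by positivity) ?_
    refine Runs.assign_then rfl ⟨rfl, by decide⟩ (by positivity) ?_
    dsimp
    refine Runs.seq_le (k₁ := numSolutions V r * m * ((5 * m + 16) + 2) + 2) (k₂ := 2) (by omega)
      (Runs.loopLt (fun q s => ∃ i acc bad x c L' A7 A8 g' h',
      s = ⟨[L, m, n, r, 2 ^ m, q, i, acc, bad, x, c, tl, y, lev, L'],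
        [A0, A1, A2, A3, A4, A5, A6, A7, A8, A9]⟩ ∧
      ExtendInv V r lev L g h q L' A7 A8 g' h') (numSolutions V r * m)
      ⟨_, _, _, _, _, _, _, _, _, _, rfl, hl.extendInv⟩ ?_ ?_ ?_)
    · rintro q s ⟨i, acc, bad, x, c, L', A7, A8, g', h', rfl, -⟩
      exact ⟨⟨rfl, by decide⟩, ⟨rfl, by decide⟩⟩
    · rintro q s - ⟨i, acc, bad, x, c, L', A7, A8, g', h', rfl, hx⟩ hq
      dsimp at hq
      exact ⟨hq.trans_le hLn, extendProg_runs hm hn hb hmm hrb (hLn.trans_lt hLb) hA2 hA6 hA5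
        hl.inj hlev hq hx⟩
    · rintro q s ⟨i, acc, bad, x, c, L', A7, A8, g', h', rfl, hx⟩ hq
      dsimp at hq
      have hx' := hx.levelInv hl.complete hl.inj hlev (by omega)
      refine Runs.assign_then rfl ⟨rfl, by decide⟩ (hx.le.trans_lt hrb) ?_
      refine Runs.assign' rfl ⟨rfl, by decide⟩ (by dsimp; omega) ?_
      exact ⟨_, _, _, _, _, _, _, _, _, _, _, _, rfl, hlev, hx'⟩
  · rintro lev s ⟨L, q, i, acc, bad, x, c, L', A7, A8, g, h, rfl, hle, hl⟩ hlt
    dsimp at hlt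
    obtain rfl : lev = m := by omega
    obtain rfl := hl.eq_numSolutions
    exact ⟨_, _, _, _, _, _, _, _, _, _, _, _, rfl, hl⟩

theorem outProg_runs (hm : 0 < m) (hmb : m < 2 ^ b) (hLb : L * m < 2 ^ b)
    (hA9 : ∀ i ≤ m, A9 i = m ^ i) (hcol : Column V m L A7 A8 g h) :
    Runs b outProg ⟨[L, m, n, r, F, q, i, acc, bad, x, c, tl, y, lev, L'],
      [A0, A1, A2, A3, A4, A5, A6, A7, A8, A9]⟩ (L * m * 4 + 3)
      fun s => ∃ q A1,
      s = ⟨[L, m, n, r, F, q, i, acc, bad, x, c, tl, y, lev, L'],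
        [A0, A1, A2, A3, A4, A5, A6, A7, A8, A9]⟩ ∧
      ∀ e < L, ∀ j : Fin m, A1 (e * m + j) = codeNum (g e) / m ^ (j : ℕ) % m := by
  refine Runs.mono (k := L * m * (2 + 2) + 2 + 1) ?_ (by omega) fun _ h => h
  refine Runs.assign_then rfl ⟨rfl, by decide⟩ (by positivity) ?_
  dsimp
  refine Runs.loopLt (fun q s => ∃ A1,
      s = ⟨[L, m, n, r, F, q, i, acc, bad, x, c, tl, y, lev, L'],
        [A0, A1, A2, A3, A4, A5, A6, A7, A8, A9]⟩ ∧
      ∀ e < L, ∀ j : Fin m, e * m + j < q →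
        A1 (e * m + j) = codeNum (g e) / m ^ (j : ℕ) % m) (L * m) ⟨_, rfl, by simp⟩ ?_ ?_ ?_
  · rintro q s ⟨A1, rfl, -⟩
    exact ⟨⟨rfl, by decide⟩, ⟨rfl, by decide⟩⟩
  · rintro q s - ⟨A1, rfl, hA1⟩ hq
    dsimp at hq
    refine ⟨hq, ?_⟩
    refine Runs.storeAt_then rfl ⟨rfl, by decide⟩ ⟨rfl, by decide⟩ ?_ ?_
    · exact (Nat.mod_lt _ hm).trans hmb
    refine Runs.assign' rfl ⟨rfl, by decide⟩ (by dsimp; omega) ⟨_, rfl, ?_⟩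
    intro e he j hlt
    dsimp
    rcases eq_or_lt_of_le (Nat.lt_succ_iff.1 hlt) with rfl | hlt
    · rw [Function.update_self, flat_div j.2, flat_mod j.2, (hcol e he).2.2.2, hA9 _ j.2.le]
    · rw [Function.update_of_ne hlt.ne, hA1 e he j hlt]
  · rintro q s ⟨A1, rfl, hA1⟩ hq
    dsimp at hq
    exact ⟨_, _, rfl, fun e he j => hA1 e he j ((flat_lt he j.2).trans_le (by omega))⟩

end Enumeration

/-! ### The whole program -/

section Main

variable {m n : ℕ}

/-- The store in which the program is started. -/
def startStore (w : List ℕ) : Store :=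
  ⟨[0, 0, 0, 0, 0, 0, 0, 0, 0, 0, 0, 0, 0, 0, 0],
    [fun i => w.getD i 0, fun _ => 0, fun _ => 0, fun _ => 0, fun _ => 0, fun _ => 0, fun _ => 0,
      fun _ => 0, fun _ => 0, fun _ => 0]⟩

theorem startStore_models (w : List ℕ) : (startStore w).Models (startState w) := by
  refine ⟨by simp [startStore], fun x hx => ?_, fun a ha => ?_⟩
  · simp only [startStore, List.length_cons, List.length_nil] at hx
    interval_cases x <;> rfl
  · simp only [startStore, List.length_cons, List.length_nil] at ha
    interval_cases a <;> rfl

theorem size_le_bitSize {w : List ℕ} {v : ℕ} (hv : v ∈ w) : 1 + Nat.size v ≤ bitSize w :=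
  List.single_le_sum (by simp) _ (List.mem_map_of_mem hv)

theorem length_le_bitSize (w : List ℕ) : w.length ≤ bitSize w := by
  induction w with
  | nil => simp
  | cons v w ih =>
    simp only [bitSize, List.map_cons, List.sum_cons, List.length_cons] at ih ⊢
    omega

theorem startStore_bounded {w : List ℕ} {b : ℕ} (hb : 2 ≤ b) (hw : bitSize w ≤ b) :
    (startStore w).Bounded b := by
  refine ⟨hb, by simp [startStore], fun A hA i => ?_⟩
  have hpos : 0 < 2 ^ b := by positivity
  have hget : w.getD i 0 < 2 ^ b := by
    by_cases hi : i < w.length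
    · rw [List.getD_eq_getElem _ _ hi]
      have := size_le_bitSize (List.getElem_mem hi)
      exact Nat.size_le.1 (by omega)
    · rw [List.getD_eq_default _ _ (by omega)]
      exact hpos
  simp only [startStore, List.mem_cons, List.not_mem_nil, or_false, or_self] at hA
  rcases hA with rfl | rfl
  · exact hget
  · exact hpos

theorem flatten_votes (V : Profile m n) (hm : 0 < m) :
    (List.ofFn fun i : Fin n => rankingList (V i)).flatten = List.ofFn fun k : Fin (n * m) =>
      ((V ⟨k / m, Nat.div_lt_of_lt_mul (k.2.trans_eq (mul_comm n m))⟩).symm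
        ⟨k % m, Nat.mod_lt _ hm⟩ : ℕ) := by
  rw [List.ofFn_mul]
  simp only [rankingList, flat_div (Fin.is_lt _), flat_mod (Fin.is_lt _), Fin.eta]

theorem length_instanceInput (V : Profile m n) (hm : 0 < m) (r : ℕ) :
    (instanceInput V r).length = n * m + 3 := by
  simp [instanceInput, flatten_votes V hm]

theorem instanceInput_getD (V : Profile m n) (r : ℕ) (i : Fin n) (j : Fin m) :
    (instanceInput V r).getD (3 + (i * m + j)) 0 = ((V i).symm j : ℕ) := by
  have hlt := flat_lt i.2 j.2
  rw [instanceInput, add_comm, flatten_votes V j.pos]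
  simp only [getD_cons_succ']
  rw [List.getD_eq_getElem _ _ (by simpa using hlt), List.getElem_ofFn]
  simp only [flat_div j.2, flat_mod j.2, Fin.eta]

/-- The running time of the program in units. -/
def totalSteps (V : Profile m n) (r : ℕ) : ℕ :=
  3 + (5 * m + 6) + (n * m * 4 + 3) + (m * m * (n * 4 + 8) + 3) +
    (nodeBound V * m * (5 * m + 15) + 6) + ((m * m * n + 1) * 3 + 3) +
    (m * (numSolutions V r * m * (5 * m + 18) + 8) + 8) + (numSolutions V r * m * 4 + 3)

theorem kemenyProg_runs (V : Profile m n) (r b : ℕ) (hm : 0 < m) (hn : 0 < n)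
    (hb : (m * m * n + m * n + 4) * 2 ^ m < 2 ^ b) (hmm : m ^ m < 2 ^ b) (hrb : r < 2 ^ b)
    (hnode : nodeBound V * m < 2 ^ b) (hLb : numSolutions V r * m < 2 ^ b) :
    Runs b kemenyProg (startStore (instanceInput V r)) (totalSteps V r) fun s =>
      ∀ σ, s.Models σ → IsCorrectOutput V r σ := by
  obtain ⟨hbs, hb1, hb3, hb2⟩ := bounds_of_main hm hn hb
  have hmb : m < 2 ^ b := by omega
  have hnb : n < 2 ^ b := lt_of_le_of_lt (Nat.le_mul_of_pos_right n hm) hb3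
  rw [startStore]
  refine Runs.mono (k := (5 * m + 6) + ((n * m * 4 + 3) + ((m * m * (n * 4 + 8) + 3) +
    ((nodeBound V * m * (5 * m + 15) + 6) + (((m * m * n + 1) * 3 + 3) +
    ((m * (numSolutions V r * m * (5 * m + 18) + 8) + 8) +
      (numSolutions V r * m * 4 + 3)))))) + 3) ?_ (by rw [totalSteps]; omega) fun _ h => h
  refine Runs.assign_then rfl ⟨rfl, by decide⟩ hmb ?_
  refine Runs.assign_then rfl ⟨rfl, by decide⟩ hnb ?_
  refine Runs.assign_then rfl ⟨rfl, by decide⟩ hrb ?_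
  change Runs b _ ⟨[0, m, n, r, 0, 0, 0, 0, 0, 0, 0, 0, 0, 0, 0],
    [fun i => (instanceInput V r).getD i 0, fun _ => 0, fun _ => 0, fun _ => 0, fun _ => 0,
      fun _ => 0, fun _ => 0, fun _ => 0, fun _ => 0, fun _ => 0]⟩ _ _
  refine Runs.seq ((powProg_runs hm hmb hb2 hmm).mono le_rfl ?_)
  rintro s ⟨q, A6, A9, rfl, h6, h9⟩
  refine Runs.seq ((posProg_runs V hb3 (instanceInput_getD V r)).mono le_rfl ?_)
  rintro s ⟨q, A3, rfl, h3⟩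
  refine Runs.seq ((votesProg_runs V hb1 hnb h3).mono le_rfl ?_)
  rintro s ⟨q, i, acc, A2, rfl, h2⟩
  refine Runs.seq ((searchProg_runs V hm hn hb hnode h2 h6).mono le_rfl ?_)
  rintro s ⟨q, i, acc, bad, x, c, tl, y, A4, A5, rfl, h5⟩
  refine Runs.seq ((goalProg_runs V hm hn hb h5).mono le_rfl ?_)
  rintro s ⟨p, hp, rfl⟩
  refine Runs.seq ((enumProg_runs hm hn hb hmm hrb hLb h2 h6 h5 hp).mono le_rfl ?_)
  rintro s ⟨q, i, acc, bad, x, c, lev, L', A7, A8, g, h, rfl, hl⟩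
  refine (outProg_runs hm hmb hLb h9 hl.col).mono le_rfl ?_
  rintro s ⟨q, A1, rfl, hA1⟩ σ ⟨-, hreg, hmem⟩
  refine ⟨hreg 0 (by simp), ?_⟩
  have hex : ∀ e : Fin (numSolutions V r), ∃ Q ∈ kemenyRankings V, revList Q = g e := by
    intro e
    obtain ⟨hlen, hopt, -⟩ := hl.col e e.2
    obtain ⟨Q, hQ, hQe⟩ := hopt.exists_ranking
    have hnil : h e = [] := by
      have := congrArg List.length hQe
      simp [revList, hlen] at this
      exact this
    exact ⟨Q, hQ, by simpa [hnil] using hQe⟩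
  choose Q hQ hQg using hex
  refine ⟨Q, fun e e' he => ?_, hQ, fun e j => ?_⟩
  · have : g e = g e' := by rw [← hQg, ← hQg, he]
    exact Fin.ext (hl.inj e.2 e'.2 this)
  · rw [hmem 1 (by simp)]
    change A1 _ = _
    rw [hA1 e e.2 j, ← hQg, codeNum_revList]

/-! ### Time and word length in terms of the input size -/

theorem maxRange_le (V : Profile m n) (hm : 0 < m) : maxRange V ≤ m := by
  refine Finset.sup_le fun c _ => ?_
  have : (Finset.univ.sup fun p : Fin n × Fin n =>
      ((pos (V p.1) c : ℤ) - (pos (V p.2) c : ℤ)).natAbs) ≤ m - 1 := by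
    refine Finset.sup_le fun p _ => ?_
    simp only [pos_eq]
    omega
  rw [range]
  omega

theorem totalSteps_le (V : Profile m n) (r X : ℕ) (hX : m * n + 3 + numSolutions V r ≤ X)
    (hm : 0 < m) (hn : 0 < n) : totalSteps V r ≤ 300 * 32 ^ maxRange V * X ^ 6 := by
  have hmn : m ≤ m * n := Nat.le_mul_of_pos_right _ hn
  have hnm : n ≤ m * n := Nat.le_mul_of_pos_left _ hm
  have hmX : m ≤ X := by omega
  have hnX : n ≤ X := by omega
  have hlX : numSolutions V r ≤ X := by omega
  have h3 : m * m * n + 1 ≤ X ^ 3 := by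
    have h1 : m * (m * n) ≤ X * (X - 1) := Nat.mul_le_mul hmX (by omega)
    obtain ⟨Z, rfl⟩ : ∃ Z, X = Z + 1 := ⟨X - 1, by omega⟩
    rw [Nat.add_sub_cancel] at h1
    nlinarith [Nat.zero_le (Z ^ 3)]
  -- The windows contribute only `4 ^ maxRange V`; base 32 is more than enough.
  have hE : 2 ^ (2 * maxRange V) ≤ 32 ^ maxRange V := by
    rw [pow_mul]
    exact Nat.pow_le_pow_left (by norm_num) _
  have hE1 : 1 ≤ 32 ^ maxRange V := Nat.one_le_pow _ _ (by norm_num)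
  have hX1 : 1 ≤ X := by omega
  have pw : ∀ i ≤ 6, X ^ i ≤ X ^ 6 := fun i hi => Nat.pow_le_pow_right hX1 hi
  have p0 := pw 0 (by norm_num)
  have p1 := pw 1 (by norm_num)
  have p2 := pw 2 (by norm_num)
  have p3 := pw 3 (by norm_num)
  have p4 := pw 4 (by norm_num)
  have hmain : nodeBound V * m * (5 * m + 15) ≤ 20 * (32 ^ maxRange V * X ^ 6) := by
    calc nodeBound V * m * (5 * m + 15)
        ≤ (X * 32 ^ maxRange V * X ^ 3) * X * (5 * X + 15 * X) := by
          rw [nodeBound]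
          gcongr <;> omega
      _ = 20 * (32 ^ maxRange V * X ^ 6) := by ring
  have hrest : 3 + (5 * m + 6) + (n * m * 4 + 3) + (m * m * (n * 4 + 8) + 3) +
      6 + ((m * m * n + 1) * 3 + 3) +
      (m * (numSolutions V r * m * (5 * m + 18) + 8) + 8) + (numSolutions V r * m * 4 + 3)
      ≤ 280 * X ^ 6 := by
    calc _ ≤ 3 + (5 * X + 6) + (X * X * 4 + 3) + (X * X * (X * 4 + 8) + 3) +
      6 + (X ^ 3 * 3 + 3) + (X * (X * X * (5 * X + 18) + 8) + 8) + (X * X * 4 + 3) := by gcongr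
      _ = 35 * X ^ 0 + 13 * X ^ 1 + 16 * X ^ 2 + 25 * X ^ 3 + 5 * X ^ 4 := by ring
      _ ≤ _ := by omega
  have : 280 * X ^ 6 ≤ 280 * (32 ^ maxRange V * X ^ 6) :=
    Nat.mul_le_mul_left _ (Nat.le_mul_of_pos_left _ hE1)
  rw [totalSteps, mul_assoc 300]
  omega

end Main

end Kemeny

theorem mainTheorem4 :
    ∃ (P : Kemeny.Prog) (C k : ℕ),
      ∀ (m n r : ℕ), 0 < m → 0 < n → ∀ V : Kemeny.Profile m n,
        ∃ (t : ℕ) (s : Kemeny.State),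
          Kemeny.Exec P (Kemeny.startState (Kemeny.instanceInput V r)) t s ∧
          Kemeny.IsCorrectOutput V r s ∧
          t ≤ C * 32 ^ Kemeny.maxRange V *
            (Kemeny.bitSize (Kemeny.instanceInput V r) + Kemeny.numSolutions V r) ^ k := by
  -- The word length will be `20 * X ^ 2`, quadratic because suffix codes range up to `m ^ m`. A
  -- statement then costs at most `200 * 801 ^ 2 * X ^ 4`, where `801 = 1 + 20 * 40`, and
  -- `totalSteps_le` contributes the factor 300 and the sixth power, so the exponent is `6 + 4`.
  refine ⟨Kemeny.kemenyProg, 300 * (200 * 801 ^ 2), 10, fun m n r hm hn V => ?_⟩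
  set w := Kemeny.instanceInput V r with hw
  set X := Kemeny.bitSize w + Kemeny.numSolutions V r with hX
  have hlen : n * m + 3 ≤ Kemeny.bitSize w := by
    rw [← Kemeny.length_instanceInput V hm r]
    exact Kemeny.length_le_bitSize _
  rw [mul_comm n m] at hlen
  have hmn : m ≤ m * n := Nat.le_mul_of_pos_right _ hn
  have hnm : n ≤ m * n := Nat.le_mul_of_pos_left _ hm
  have hX2 : X ≤ X ^ 2 := Nat.le_self_pow (by norm_num) X
  have hY : X < 2 ^ X := Nat.lt_two_pow_self
  have hpow : ∀ j, j ≤ 20 * X ^ 2 → (2 : ℕ) ^ j ≤ 2 ^ (20 * X ^ 2) := fun j hj =>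
    Nat.pow_le_pow_right two_pos hj
  have h3 : m * m * n + m * n + 4 < 2 ^ (3 * X) := by
    have h1 : m * (m * n) ≤ X * X := Nat.mul_le_mul (by omega) (by omega)
    calc m * m * n + m * n + 4 ≤ X ^ 3 := by nlinarith
      _ < (2 ^ X) ^ 3 := Nat.pow_lt_pow_left hY (by norm_num)
      _ = 2 ^ (3 * X) := by rw [← pow_mul, mul_comm]
  have hb : (m * m * n + m * n + 4) * 2 ^ m < 2 ^ (20 * X ^ 2) := by
    calc _ < 2 ^ (3 * X) * 2 ^ m := Nat.mul_lt_mul_of_pos_right h3 (by positivity)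
      _ = 2 ^ (3 * X + m) := (pow_add _ _ _).symm
      _ ≤ _ := hpow _ (by omega)
  have hmm : m ^ m < 2 ^ (20 * X ^ 2) := by
    calc m ^ m < (2 ^ X) ^ m := Nat.pow_lt_pow_left (by omega) hm.ne'
      _ = 2 ^ (X * m) := (pow_mul _ _ _).symm
      _ ≤ _ := hpow _ (by nlinarith)
  have hrb : r < 2 ^ (20 * X ^ 2) := by
    have : 1 + Nat.size r ≤ Kemeny.bitSize w :=
      Kemeny.size_le_bitSize (by simp [hw, Kemeny.instanceInput])
    exact (Nat.lt_size_self r).trans_le (hpow _ (by omega))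
  have hnode : Kemeny.nodeBound V * m < 2 ^ (20 * X ^ 2) := by
    -- This keeps the bit length of the number of keys linear in `X`, so the exponential dependence
    -- enters the step count only and not the cost of a step.
    have hR := Kemeny.maxRange_le V hm
    calc _ = (m + 1) * 2 ^ (2 * Kemeny.maxRange V) * (m * m * n + 1) * m := rfl
      _ ≤ 2 ^ X * 2 ^ (2 * X) * 2 ^ (3 * X) * m := by
        gcongr
        · omega
        · norm_num
        · omega
        · omega
      _ < 2 ^ X * 2 ^ (2 * X) * 2 ^ (3 * X) * 2 ^ X :=
        Nat.mul_lt_mul_of_pos_left (by omega) (by positivity)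
      _ = 2 ^ (7 * X) := by rw [← pow_add, ← pow_add, ← pow_add]; congr 1; ring
      _ ≤ _ := hpow _ (by omega)
  have hLb : Kemeny.numSolutions V r * m < 2 ^ (20 * X ^ 2) := by
    calc _ < 2 ^ X * 2 ^ X := Nat.mul_lt_mul'' (by omega) (by omega)
      _ = 2 ^ (X + X) := (pow_add _ _ _).symm
      _ ≤ _ := hpow _ (by omega)
  have hwb : Kemeny.bitSize w ≤ 20 * X ^ 2 := by omega
  obtain ⟨t, s', σ, hexec, hmod, -, ht, hcorrect⟩ :=
    Kemeny.kemenyProg_runs V r _ hm hn hb hmm hrb hnode hLb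
      (Kemeny.startStore_bounded (by omega) hwb) _ (Kemeny.startStore_models _)
  refine ⟨t, σ, hexec, hcorrect σ hmod, ht.trans ?_⟩
  have hunit : Kemeny.unitCost (20 * X ^ 2) ≤ 200 * 801 ^ 2 * X ^ 4 := by
    calc Kemeny.unitCost (20 * X ^ 2) = 200 * (1 + 20 * X ^ 2 * 40) ^ 2 := rfl
      _ ≤ 200 * (801 * X ^ 2) ^ 2 := by
        gcongr
        omega
      _ = 200 * 801 ^ 2 * X ^ 4 := by ring
  calc _ ≤ (300 * 32 ^ Kemeny.maxRange V * X ^ 6) * (200 * 801 ^ 2 * X ^ 4) :=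
        Nat.mul_le_mul (Kemeny.totalSteps_le V r X (by omega) hm hn) hunit
    _ = _ := by ring
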